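/- Let $d\ge 0$ and $k\ge 4$ be integers and let $a_1,\dots,a_k$ be positive integers with $a_1+\dots+a_k=\binom{d+2}{2}$. The $k$-chain $C_{a_1,\dots,a_k}$ is the graph whose vertex set is a disjoint union $A_1\cup\dots\cup A_k$ with $|A_i|=a_i$, in which two vertices are adjacent exactly when one lies in $A_i$ and the other in $A_{i+1}$ for some $1\le i\le k-1$. For a finite graph $G=(V,E)$, a realization is a map $p:V\to\mathbb{R}^d$; it is generic if its $d|V|$ coordinates are algebraically independent over $\mathbb{Q}$. Two realizations are $G$-equivalent if they assign the same length to every edge of $G$, and congruent if they give the same distance for every pair of vertices. The framework $G(p)$ is locally rigid if for every differentiable family $(p_t)_{t\in\mathbb{R}}$ of realizations with $p_0=p$ and all $p_t$ $G$-equivalent to $p$, every $p_t$ is congruent to $p$. It is redundantly rigid if removing any single edge leaves a locally rigid framework, and globally rigid if every realization that is $G$-equivalent to $p$ is congruent to $p$. $G$ is generically redundantly (respectively, globally) rigid in $\mathbb{R}^d$ if $G(p)$ is redundantly (respectively, globally) rigid for every generic $p$. $G$ is $(d+1)$-connected if it has more than $d+1$ vertices and removing any set of at most $d$ vertices leaves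 a connected graph. $G$ is generically partially rigid in $\mathbb{R}^d$ if it is $(d+1)$-connected and generically redundantly rigid in $\mathbb{R}^d$, but not generically globally rigid in $\mathbb{R}^d$. Then $C_{a_1,\dots,a_k}$ is generically partially rigid in $\mathbb{R}^d$ if and only if all of the following hold: 1. $a_i\ge d+1$ for all $2\le i\le k-1$; 2. $a_2\ge d+2$ and $a_{k-1}\ge d+2$; 3. there is no $i$ with $1\le i\le k-1$ and $a_i=a_{i+1}=d+1$. -/

import Mathlib

namespace Rigidity

/-- The `k`-chain `C_{a_1,…,a_k}` (parts indexed from `0`): the `i`-th part has `a i` vertices, two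
vertices are adjacent exactly when they lie in consecutive parts. -/
def chain {k : ℕ} (a : Fin k → ℕ) : SimpleGraph (Σ i : Fin k, Fin (a i)) where
  Adj u v := u.1.val + 1 = v.1.val ∨ v.1.val + 1 = u.1.val
  symm := ⟨fun _ _ h => h.symm⟩
  loopless := ⟨fun _ h => by rcases h with h | h <;> omega⟩

/-- Vertex `m`-connectedness: more than `m` vertices, and removing fewer than `m` vertices always
leaves a connected graph. -/
def VertexConnected {V : Type*} [Fintype V] (G : SimpleGraph V) (m : ℕ) : Prop :=
  m < Fintype.card V ∧ ∀ S : Finset V, S.card < m → (G.induce {v | v ∉ S}).Connected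

/-- A realization of the vertex set `V` in `ℝ^d`. -/
abbrev Realization (V : Type*) (d : ℕ) : Type _ := V → EuclideanSpace ℝ (Fin d)

/-- The coordinates of all the vertices form an algebraically independent family over `ℚ`. -/
def Generic {V : Type*} {d : ℕ} (p : Realization V d) : Prop :=
  AlgebraicIndependent ℚ (fun x : V × Fin d => p x.1 x.2)

/-- `f_G(p) = f_G(q)`: the frameworks `G(p)` and `G(q)` have the same edge lengths. -/
def SameLengths {V : Type*} {d : ℕ} (G : SimpleGraph V) (p q : Realization V d) : Prop :=
  ∀ u v, G.Adj u v → dist (p u) (p v) = dist (q u) (q v)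

/-- `p` and `q` have the same edge lengths for the complete graph on `V`, that is, all pairwise
distances agree; equivalently, they differ by a Euclidean motion (reflections allowed). -/
def Congruent {V : Type*} {d : ℕ} (p q : Realization V d) : Prop :=
  SameLengths (⊤ : SimpleGraph V) p q

/-- `γ` is a flexing of `G(p)`: a differentiable one-parameter family of realizations through `p`,
all with the edge lengths of `G(p)`. -/
def IsFlexing {V : Type*} [Fintype V] {d : ℕ} (G : SimpleGraph V) (p : Realization V d)
    (γ : ℝ → Realization V d) : Prop :=
  Differentiable ℝ γ ∧ γ 0 = p ∧ ∀ t, SameLengths G p (γ t)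

/-- All flexings of `G(p)` are trivial. -/
def LocallyRigid {V : Type*} [Fintype V] {d : ℕ} (G : SimpleGraph V) (p : Realization V d) :
    Prop :=
  ∀ γ : ℝ → Realization V d, IsFlexing G p γ → ∀ t, Congruent p (γ t)

/-- Every framework with the edge lengths of `G(p)` is congruent to it. -/
def GloballyRigid {V : Type*} {d : ℕ} (G : SimpleGraph V) (p : Realization V d) : Prop :=
  ∀ q : Realization V d, SameLengths G p q → Congruent p q

/-- Removing any one edge leaves a locally rigid framework. -/
def RedundantlyRigid {V : Type*} [Fintype V] {d : ℕ} (G : SimpleGraph V) (p : Realization V d) :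
    Prop :=
  ∀ e ∈ G.edgeSet, LocallyRigid (G.deleteEdges {e}) p

/-- All generic frameworks of `G` in `ℝ^d` are redundantly rigid. -/
def GenericallyRedundantlyRigid {V : Type*} [Fintype V] (G : SimpleGraph V) (d : ℕ) : Prop :=
  ∀ p : Realization V d, Generic p → RedundantlyRigid G p

/-- All generic frameworks of `G` in `ℝ^d` are globally rigid. -/
def GenericallyGloballyRigid {V : Type*} (G : SimpleGraph V) (d : ℕ) : Prop :=
  ∀ p : Realization V d, Generic p → GloballyRigid G p

/-- Generic partial rigidity in `ℝ^d`: the graph satisfies the two necessary conditions for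
generic global rigidity, but is not generically globally rigid. -/
def GenericallyPartiallyRigid {V : Type*} [Fintype V] (G : SimpleGraph V) (d : ℕ) : Prop :=
  VertexConnected G (d + 1) ∧ GenericallyRedundantlyRigid G d ∧ ¬ GenericallyGloballyRigid G d

end Rigidity

/-!
Write `N = d + 1`, let `x̂ = (1, x)` be the homogeneous coordinates of a point `x ∈ ℝ^d`, and note
that a chain is bipartite and has as many vertices as there are coefficients of a quadric in `ℝ^d`,
that is, of a quadratic form on `ℝ^N`. The proof rests on two consequences of genericity: any `N`
vertices are affinely independent (`Generic.eq_zero_of_dotProduct_hat`), and no quadric passes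
through all vertices (`Generic.quadForm_injective`). Both hold because the rank of a matrix of
rational polynomials is maximal at generic points (`rank_map_aeval_le`).

*Rigidity.* For an infinitesimal motion `x` the vectors `y_v = (-⟪x_v, p_v⟫, x_v) ∈ ℝ^N` satisfy
`y_u ⬝ v̂ + y_v ⬝ û = 0` on the edges. One solution of these equations is `y_u = M û` on one
colour and `y_v = -Mᵀ v̂` on the other, for any matrix `M`. If all vertices can be reached from `N`
vertices of one colour by adding vertices with `N` neighbours already reached, there are no other
solutions. As `y_v ⬝ v̂ = 0`, the quadric of `M` contains all the vertices, so `M` is skew-symmetric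
and the motion is trivial (`Generic.infinitesimallyRigid_of_propagation`). Under the three
conditions on the sizes of the parts this applies to the chain with any one edge removed.
Infinitesimal rigidity implies local rigidity (`InfinitesimallyRigid.locallyRigid`) by averaging: if
`p` and `q` have the same edge lengths, then `p - q` is an infinitesimal motion at `p + q`.

*Failure of global rigidity.* Displace points `x_v` of a quadric by plus or minus the gradient at
`x_v`, the sign being the colour of `v`; reversing all the signs does not change the lengths of the
edges (`sameLengths_displace`). Quadrics and points on them have together as many parameters as
there are coordinates, and at suitable points of a sphere the inverse function theorem shows that
the displaced points fill an open set (`map_nhds_displace`), which contains generic realizations.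

*Necessity.* Connectivity forces the inner parts to have at least `N` vertices. At a generic
realization, the two sides of `∑_v σ(u, v) v̂ = λ_u û` for a stress `σ` yield a linear dependency of
the symmetric squares of the `v̂`, whence `λ = 0` (`IsStress.sum_hat_eq_zero`). It follows that
stresses vanish between an end part and a neighbouring part with `N` vertices, and between two
consecutive parts with `N` vertices each. After removing an edge on which all stresses vanish, an
infinitesimal motion changes its length, and by the implicit function theorem a generic framework
with such a motion is flexible (`Generic.not_locallyRigid`).
-/

namespace Rigidity

open Module Filter Topology

/-! ### Generic realizations -/

/-- The rank of a matrix of rational polynomials is largest at algebraically independent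
points. Over `ℝ` a family of rows is independent exactly when its Gram determinant, again a
rational polynomial, does not vanish. -/
theorem rank_map_aeval_le {σ m n : Type*} [Fintype m] [Fintype n]
    (M : Matrix m n (MvPolynomial σ ℚ)) {x : σ → ℝ} (hx : AlgebraicIndependent ℚ x) (y : σ → ℝ) :
    (M.map (MvPolynomial.aeval y)).rank ≤ (M.map (MvPolynomial.aeval x)).rank := by
  classical
  obtain ⟨κ, f, hf, hspan, hind⟩ :=
    exists_linearIndependent' ℝ (M.map (MvPolynomial.aeval y)).row
  have : Fintype κ := Fintype.ofInjective f hf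
  set B : Matrix κ n (MvPolynomial σ ℚ) := M.submatrix f id with hB
  have hrank : (M.map (MvPolynomial.aeval y)).rank = Fintype.card κ := by
    rw [Matrix.rank_eq_finrank_span_row, ← hspan]
    exact finrank_span_eq_card hind
  have hdet : ∀ z : σ → ℝ, MvPolynomial.aeval z (B * B.transpose).det =
      (B.map (MvPolynomial.aeval z) * (B.map (MvPolynomial.aeval z)).transpose).det := by
    intro z
    rw [AlgHom.map_det]
    congr 1
    ext i j
    simp [Matrix.mul_apply]
  have hy : MvPolynomial.aeval y (B * B.transpose).det ≠ 0 := by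
    rw [hdet]
    intro h0
    obtain ⟨v, hv, h⟩ := Matrix.exists_mulVec_eq_zero_iff.2 h0
    have h1 := (Matrix.self_mul_conjTranspose_mulVec_eq_zero (B.map (MvPolynomial.aeval y)) v).1
      (by rw [Matrix.conjTranspose_eq_transpose_of_trivial]; exact h)
    rw [Matrix.conjTranspose_eq_transpose_of_trivial] at h1
    refine hv (funext fun i => ?_)
    refine Fintype.linearIndependent_iff.1 hind v ?_ i
    ext j
    have h2 := congrFun h1 j
    simp only [Matrix.mulVec, dotProduct, Matrix.transpose_apply, Pi.zero_apply] at h2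
    rw [Finset.sum_apply, Pi.zero_apply, ← h2]
    exact Finset.sum_congr rfl fun k _ => mul_comm _ _
  have hx' : MvPolynomial.aeval x (B * B.transpose).det ≠ 0 := by
    intro h0
    apply hy
    rw [(injective_iff_map_eq_zero _).1 hx _ h0, map_zero]
  rw [hdet] at hx'
  have h2 := Matrix.rank_of_det_ne_zero hx'
  rw [Matrix.rank_self_mul_transpose] at h2
  rw [hrank, ← h2]
  exact Matrix.rank_submatrix_le (M.map (MvPolynomial.aeval x)) f id

theorem mulVec_injective_iff_rank {m n : Type*} [Fintype n]
    (A : Matrix m n ℝ) : (∀ c, A.mulVec c = 0 → c = 0) ↔ A.rank = Fintype.card n := by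
  have h := LinearMap.finrank_range_add_finrank_ker A.mulVecLin
  rw [finrank_fintype_fun_eq_card] at h
  have h1 : (∀ c, A.mulVec c = 0 → c = 0) ↔ finrank ℝ (LinearMap.ker A.mulVecLin) = 0 := by
    rw [Submodule.finrank_eq_zero, Submodule.eq_bot_iff]
    simp
  rw [h1, Matrix.rank]
  omega

theorem mulVec_injective_of_generic {σ m n : Type*} [Fintype m] [Fintype n]
    (M : Matrix m n (MvPolynomial σ ℚ)) {x : σ → ℝ} (hx : AlgebraicIndependent ℚ x) (y : σ → ℝ)
    (h : ∀ c, (M.map (MvPolynomial.aeval y)).mulVec c = 0 → c = 0) :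
    ∀ c, (M.map (MvPolynomial.aeval x)).mulVec c = 0 → c = 0 := by
  rw [mulVec_injective_iff_rank] at h ⊢
  refine le_antisymm (Matrix.rank_le_card_width _) ?_
  rw [← h]
  exact rank_map_aeval_le M hx y

/-- Algebraically independent points are dense: the coordinates are chosen one after another, and
each has to avoid only the countably many numbers algebraic over the previous ones. -/
theorem exists_algebraicIndependent_near {σ : Type*} [Finite σ] (x : σ → ℝ) {ε : ℝ} (hε : 0 < ε) :
    ∃ y : σ → ℝ, AlgebraicIndependent ℚ y ∧ ∀ i, |y i - x i| < ε := by
  induction σ using Finite.induction_empty_option with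
  | of_equiv e ih =>
    obtain ⟨y, hy, hxy⟩ := ih (x ∘ e)
    refine ⟨y ∘ e.symm, (algebraicIndependent_equiv e.symm).2 hy, fun i => ?_⟩
    simpa using hxy (e.symm i)
  | h_empty =>
    exact ⟨x, algebraicIndependent_empty_type_iff.2 (algebraMap ℚ ℝ).injective, fun i => i.elim⟩
  | h_option ih =>
    rename_i τ _
    obtain ⟨y, hy, hxy⟩ := ih (fun i => x (some i))
    have hcount : Countable (Algebra.adjoin ℚ (Set.range y)) := by
      rw [Algebra.adjoin_range_eq_range_aeval]
      have : Countable (MvPolynomial τ ℚ) := by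
        have := MvPolynomial.cardinalMk_le_max_lift (σ := τ) (R := ℚ)
        rw [← Cardinal.mk_le_aleph0_iff]
        refine this.trans ?_
        simp
      exact Set.Countable.to_subtype (Set.countable_range (MvPolynomial.aeval y))
    have h1 := Algebraic.countable (Algebra.adjoin ℚ (Set.range y)) ℝ
    have h2 : ¬ (Set.Ioo (x none - ε) (x none + ε)).Countable := by
      rw [← Cardinal.le_aleph0_iff_set_countable, Cardinal.mk_Ioo_real (by linarith)]
      exact not_le.2 Cardinal.aleph0_lt_continuum
    obtain ⟨a, ha, hna⟩ : ∃ a ∈ Set.Ioo (x none - ε) (x none + ε),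
        ¬ IsAlgebraic (Algebra.adjoin ℚ (Set.range y)) a := by
      by_contra! hcon
      exact h2 (h1.mono hcon)
    refine ⟨fun o => o.elim a y, (hy.option_iff_transcendental a).2 hna, ?_⟩
    rintro (_ | i)
    · rw [abs_lt]; constructor <;> simp at ha ⊢ <;> linarith
    · exact hxy i

theorem exists_generic_mem {V : Type*} [Finite V] {d : ℕ} {U : Set (Realization V d)}
    {p : Realization V d} (hU : U ∈ 𝓝 p) : ∃ q ∈ U, Generic q := by
  have := Fintype.ofFinite V
  let φ : (V × Fin d → ℝ) → Realization V d := fun x v => WithLp.toLp 2 fun k => x (v, k)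
  have hφ : Continuous φ := by fun_prop
  obtain ⟨ε, hε, hsub⟩ := Metric.mem_nhds_iff.1
    (hφ.continuousAt (x := fun x => p x.1 x.2) (show U ∈ 𝓝 p from hU))
  obtain ⟨y, hy, hxy⟩ := exists_algebraicIndependent_near (fun x : V × Fin d => p x.1 x.2) hε
  refine ⟨φ y, hsub ?_, hy⟩
  rw [Metric.mem_ball, dist_pi_lt_iff hε]
  exact hxy

/-! ### Homogeneous coordinates and quadrics -/

/-- The homogeneous coordinates `(1, x)` of a point `x ∈ ℝ^d`. -/
def hat {d : ℕ} (x : EuclideanSpace ℝ (Fin d)) : Fin (d + 1) → ℝ :=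
  Fin.cons 1 fun k => x k

@[simp] theorem hat_zero {d : ℕ} (x : EuclideanSpace ℝ (Fin d)) : hat x 0 = 1 := rfl

@[simp] theorem hat_succ {d : ℕ} (x : EuclideanSpace ℝ (Fin d)) (k : Fin d) :
    hat x k.succ = x k := rfl

/-- The homogeneous coordinates of a vertex as rational polynomials in all the coordinates. -/
noncomputable def hatPoly {V : Type*} {d : ℕ} (v : V) :
    Fin (d + 1) → MvPolynomial (V × Fin d) ℚ :=
  Fin.cons 1 fun k => MvPolynomial.X (v, k)

theorem aeval_hatPoly {V : Type*} {d : ℕ} (p : Realization V d) (v : V) (i : Fin (d + 1)) :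
    MvPolynomial.aeval (fun x : V × Fin d => p x.1 x.2) (hatPoly v i) = hat (p v) i := by
  refine Fin.cases ?_ (fun k => ?_) i <;> simp [hatPoly]

/-- The quadratic form on `ℝ^N` with symmetric coefficient matrix `c`. -/
def quadForm {N : ℕ} (c : Sym2 (Fin N) → ℝ) (x : Fin N → ℝ) : ℝ :=
  ∑ i, ∑ j, c s(i, j) * x i * x j

theorem quadForm_eq_sum_sym2 {N : ℕ} (c : Sym2 (Fin N) → ℝ) (x : Fin N → ℝ) :
    quadForm c x = ∑ s, (∑ i, ∑ j, if s(i, j) = s then x i * x j else 0) * c s := by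
  simp_rw [Finset.sum_mul]
  rw [Finset.sum_comm, quadForm]
  refine Finset.sum_congr rfl fun i _ => ?_
  rw [Finset.sum_comm]
  refine Finset.sum_congr rfl fun j _ => ?_
  simp only [ite_mul, zero_mul, Finset.sum_ite_eq, Finset.mem_univ, if_true]
  ring

theorem quadForm_add {N : ℕ} (c c' : Sym2 (Fin N) → ℝ) (x : Fin N → ℝ) :
    quadForm (c + c') x = quadForm c x + quadForm c' x := by
  simp [quadForm, add_mul, Finset.sum_add_distrib]

theorem quadForm_smul {N : ℕ} (t : ℝ) (c : Sym2 (Fin N) → ℝ) (x : Fin N → ℝ) :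
    quadForm (t • c) x = t * quadForm c x := by
  simp [quadForm, mul_assoc, Finset.mul_sum]

theorem card_sym2_fin (d : ℕ) : Fintype.card (Sym2 (Fin (d + 1))) = (d + 2).choose 2 := by
  simp [Sym2.card]

/-- Choosing one functional for each element of a finite set so that together they have no common
zero on a subspace of dimension at most the size of the set; it suffices that no nonzero vector is
annihilated by all the functionals available at one element. -/
theorem exists_choice_injOn {ι X W : Type*} [AddCommGroup W] [Module ℝ W] [FiniteDimensional ℝ W]
    [Nonempty X] (T : ι → X → W →ₗ[ℝ] ℝ) (s : Finset ι) :
    ∀ U : Submodule ℝ W, (∀ i ∈ s, ∀ w ∈ U, w ≠ 0 → ∃ x, T i x w ≠ 0) → finrank ℝ U ≤ s.card →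
      ∃ x : ι → X, ∀ w ∈ U, (∀ i ∈ s, T i (x i) w = 0) → w = 0 := by
  classical
  induction s using Finset.induction_on with
  | empty =>
    intro U _ hU
    refine ⟨fun _ => Classical.arbitrary X, fun w hw _ => ?_⟩
    have : U = ⊥ := Submodule.finrank_eq_zero.1 (by simpa using hU)
    simpa [this] using hw
  | insert i s hi ih =>
    intro U hT hU
    obtain ⟨x₀, hx₀⟩ : ∃ x₀, finrank ℝ ↥(U ⊓ LinearMap.ker (T i x₀)) ≤ s.card := by
      by_cases hbot : U = ⊥
      · exact ⟨Classical.arbitrary X, by rw [hbot, bot_inf_eq, finrank_bot]; exact Nat.zero_le _⟩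
      · obtain ⟨w, hw, hw0⟩ := Submodule.exists_mem_ne_zero_of_ne_bot hbot
        obtain ⟨x₀, hx₀⟩ := hT i (Finset.mem_insert_self _ _) w hw hw0
        refine ⟨x₀, ?_⟩
        have hlt : U ⊓ LinearMap.ker (T i x₀) < U := by
          refine lt_of_le_of_ne inf_le_left fun h => hx₀ ?_
          exact (h.ge hw).2
        have := Submodule.finrank_lt_finrank_of_lt hlt
        rw [Finset.card_insert_of_notMem hi] at hU
        omega
    obtain ⟨x, hx⟩ := ih (U ⊓ LinearMap.ker (T i x₀)) 
      (fun j hj w hw => hT j (Finset.mem_insert_of_mem hj) w hw.1) hx₀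
    refine ⟨Function.update x i x₀, fun w hw h => hx w ⟨hw, ?_⟩ fun j hj => ?_⟩
    · simpa using h i (Finset.mem_insert_self _ _)
    · have hji : j ≠ i := fun h => hi (h ▸ hj)
      simpa [hji] using h j (Finset.mem_insert_of_mem hj)

/-- The value of a quadratic form at a point, as a functional of its coefficients. -/
def quadFormₗ {N : ℕ} (x : Fin N → ℝ) : (Sym2 (Fin N) → ℝ) →ₗ[ℝ] ℝ where
  toFun c := quadForm c x
  map_add' c c' := quadForm_add c c' x
  map_smul' t c := quadForm_smul t c x

/-- The constant, linear and quadratic parts of a quadric in affine coordinates. -/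
theorem quadForm_hat {d : ℕ} (c : Sym2 (Fin (d + 1)) → ℝ) (x : EuclideanSpace ℝ (Fin d)) :
    quadForm c (hat x) = c s(0, 0) + 2 * ∑ k, c s(0, k.succ) * x k +
      ∑ k, ∑ l, c s(k.succ, l.succ) * x k * x l := by
  simp only [quadForm, Fin.sum_univ_succ, hat_zero, hat_succ, mul_one, Finset.sum_add_distrib]
  have : ∀ k : Fin d, c s(k.succ, 0) = c s(0, k.succ) := fun k => by rw [Sym2.eq_swap]
  simp only [this]
  ring

theorem eq_zero_of_quadForm_hat_eq_zero {d : ℕ} (c : Sym2 (Fin (d + 1)) → ℝ)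
    (h : ∀ x : EuclideanSpace ℝ (Fin d), quadForm c (hat x) = 0) : c = 0 := by
  simp only [quadForm_hat] at h
  have h0 : c s(0, 0) = 0 := by simpa using h 0
  have hs : ∀ (k : Fin d) (t : ℝ), 2 * (c s(0, k.succ) * t) + c s(k.succ, k.succ) * t * t = 0 := by
    intro k t
    have := h (EuclideanSpace.single k t)
    simpa [h0, PiLp.single_apply, Pi.single_apply, Finset.sum_ite_eq, ite_mul, mul_ite] using this
  have h1 : ∀ k : Fin d, c s(0, k.succ) = 0 := fun k => by linarith [hs k 1, hs k (-1)]
  have h2 : ∀ k : Fin d, c s(k.succ, k.succ) = 0 := fun k => by linarith [hs k 1, hs k (-1)]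
  have h3 : ∀ k l : Fin d, c s(k.succ, l.succ) = 0 := by
    intro k l
    have := h (EuclideanSpace.single k 1 + EuclideanSpace.single l 1)
    have hsw : c s(l.succ, k.succ) = c s(k.succ, l.succ) := by rw [Sym2.eq_swap]
    simp [h0, h1, h2, PiLp.single_apply, mul_ite, mul_add, Finset.sum_add_distrib, hsw] at this
    linarith
  funext s
  induction s using Sym2.ind with
  | _ i j =>
    refine Fin.cases ?_ (fun k => ?_) i <;> refine Fin.cases ?_ (fun l => ?_) j
    · exact h0
    · exact h1 l
    · rw [Sym2.eq_swap]; exact h1 k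
    · exact h3 k l

variable {V : Type*} {d : ℕ}

theorem exists_realization_quadForm_injective [Fintype V]
    (hV : Fintype.card V = (d + 2).choose 2) :
    ∃ q : Realization V d, ∀ c, (∀ v, quadForm c (hat (q v)) = 0) → c = 0 := by
  obtain ⟨x, hx⟩ := exists_choice_injOn (ι := V) (X := EuclideanSpace ℝ (Fin d))
    (fun _ x => quadFormₗ (hat x)) Finset.univ ⊤
    (fun _ _ c _ hc => by
      by_contra! hcon
      exact hc (eq_zero_of_quadForm_hat_eq_zero c hcon))
    (by simp [hV, ← card_sym2_fin d])
  exact ⟨x, fun c hc => hx c trivial fun v _ => hc v⟩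

/-- The matrix of the monomials of degree two in the homogeneous coordinates of the vertices. -/
noncomputable def monomialMatrix (V : Type*) (d : ℕ) :
    Matrix V (Sym2 (Fin (d + 1))) (MvPolynomial (V × Fin d) ℚ) :=
  Matrix.of fun v s => ∑ i, ∑ j, if s(i, j) = s then hatPoly v i * hatPoly v j else 0

theorem monomialMatrix_map (p : Realization V d) (v : V) (s : Sym2 (Fin (d + 1))) :
    ((monomialMatrix V d).map (MvPolynomial.aeval fun x : V × Fin d => p x.1 x.2)) v s =
      ∑ i, ∑ j, if s(i, j) = s then hat (p v) i * hat (p v) j else 0 := by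
  simp only [monomialMatrix, Matrix.map_apply, Matrix.of_apply, map_sum]
  refine Finset.sum_congr rfl fun i _ => Finset.sum_congr rfl fun j _ => ?_
  split_ifs <;> simp [aeval_hatPoly]

theorem monomialMatrix_mulVec (p : Realization V d) (c : Sym2 (Fin (d + 1)) → ℝ) (v : V) :
    ((monomialMatrix V d).map (MvPolynomial.aeval fun x : V × Fin d => p x.1 x.2)).mulVec c v =
      quadForm c (hat (p v)) := by
  rw [quadForm_eq_sum_sym2, Matrix.mulVec, dotProduct]
  simp only [monomialMatrix_map]

/-- No quadric passes through `(d+2 choose 2)` generic points of `ℝ^d`. -/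
theorem Generic.quadForm_injective [Fintype V] {p : Realization V d} (hp : Generic p)
    (hV : Fintype.card V = (d + 2).choose 2) (c : Sym2 (Fin (d + 1)) → ℝ)
    (hc : ∀ v, quadForm c (hat (p v)) = 0) : c = 0 := by
  obtain ⟨q, hq⟩ := exists_realization_quadForm_injective (V := V) hV
  refine mulVec_injective_of_generic (monomialMatrix V d) hp (fun x => q x.1 x.2) ?_ c ?_
  · intro c' h
    exact hq c' fun v => by rw [← monomialMatrix_mulVec]; exact congrFun h v
  · funext v
    rw [monomialMatrix_mulVec]; exact hc v

/-- The dual statement: the symmetric squares of the homogeneous coordinate vectors of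
`(d+2 choose 2)` generic points are linearly independent. -/
theorem Generic.hat_mul_hat_linearIndependent [Fintype V] {p : Realization V d} (hp : Generic p)
    (hV : Fintype.card V = (d + 2).choose 2) (μ : V → ℝ)
    (hμ : ∀ i j, ∑ v, μ v * (hat (p v) i * hat (p v) j) = 0) : μ = 0 := by
  classical
  set A := (monomialMatrix V d).map (MvPolynomial.aeval fun x : V × Fin d => p x.1 x.2) with hA
  have h1 : A.rank = Fintype.card (Sym2 (Fin (d + 1))) := by
    rw [← mulVec_injective_iff_rank]
    intro c hc
    refine hp.quadForm_injective hV c fun v => ?_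
    rw [← monomialMatrix_mulVec, ← hA, hc]; rfl
  rw [← Matrix.rank_transpose, card_sym2_fin, ← hV, ← mulVec_injective_iff_rank] at h1
  refine h1 μ (funext fun s => ?_)
  simp only [Matrix.mulVec, dotProduct, Matrix.transpose_apply, hA, monomialMatrix_map,
    Finset.sum_mul, Pi.zero_apply]
  rw [Finset.sum_comm]
  refine Finset.sum_eq_zero fun i _ => ?_
  rw [Finset.sum_comm]
  refine Finset.sum_eq_zero fun j _ => ?_
  split_ifs
  · rw [← hμ i j]
    exact Finset.sum_congr rfl fun v _ => mul_comm _ _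
  · simp

/-- `d + 1` generic points of `ℝ^d` do not lie on a hyperplane. -/
theorem Generic.eq_zero_of_dotProduct_hat {p : Realization V d} (hp : Generic p)
    {s : Finset V} (hs : d + 1 ≤ s.card) (y : Fin (d + 1) → ℝ)
    (hy : ∀ v ∈ s, y ⬝ᵥ hat (p v) = 0) : y = 0 := by
  classical
  obtain ⟨f⟩ : Nonempty (Fin (d + 1) ↪ s) :=
    Function.Embedding.nonempty_of_card_le (by simpa using hs)
  let M : Matrix (Fin (d + 1)) (Fin (d + 1)) (MvPolynomial (V × Fin d) ℚ) :=
    Matrix.of fun i j => hatPoly (f i).1 j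
  have hM : ∀ (q : Realization V d) (c : Fin (d + 1) → ℝ) (i),
      (M.map (MvPolynomial.aeval fun x : V × Fin d => q x.1 x.2)).mulVec c i =
        c ⬝ᵥ hat (q (f i).1) := by
    intro q c i
    rw [Matrix.mulVec, dotProduct_comm]
    congr 1
    funext j
    exact aeval_hatPoly q _ j
  -- the origin and the standard basis vectors span
  let q : Realization V d := fun v => WithLp.toLp 2 fun k => if v = (f k.succ).1 then 1 else 0
  refine mulVec_injective_of_generic M hp (fun x => q x.1 x.2) ?_ y ?_
  · intro c hc
    have hinj : ∀ i j, (f i).1 = (f j).1 ↔ i = j := fun i j =>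
      ⟨fun h => f.injective (Subtype.ext h), fun h => h ▸ rfl⟩
    have h : ∀ i, c ⬝ᵥ hat (q (f i).1) = 0 := fun i => by rw [← hM q c i, hc]; rfl
    have h0 : c 0 = 0 := by
      have := h 0
      simpa [dotProduct, Fin.sum_univ_succ, q, hinj, Fin.succ_ne_zero, eq_comm] using this
    funext i
    refine Fin.cases h0 (fun k => ?_) i
    have := h k.succ
    simpa [dotProduct, Fin.sum_univ_succ, q, hinj, h0] using this
  · funext i
    rw [hM]
    exact hy _ (f i).2

/-- Any `d + 1` generic points of `ℝ^d` are affinely independent. -/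
theorem Generic.hat_linearIndependent {p : Realization V d} (hp : Generic p)
    {s : Finset V} (hs : s.card = d + 1) (c : V → ℝ)
    (hc : ∀ i, ∑ v ∈ s, c v * hat (p v) i = 0) : ∀ v ∈ s, c v = 0 := by
  classical
  let A : Matrix s (Fin (d + 1)) ℝ := Matrix.of fun v i => hat (p v.1) i
  have h1 : A.rank = Fintype.card (Fin (d + 1)) := by
    rw [← mulVec_injective_iff_rank]
    intro y hy
    refine hp.eq_zero_of_dotProduct_hat hs.ge y fun v hv => ?_
    rw [dotProduct_comm]
    exact congrFun hy ⟨v, hv⟩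
  have h2 : Fintype.card (Fin (d + 1)) = Fintype.card s := by simp [hs]
  rw [← Matrix.rank_transpose, h2, ← mulVec_injective_iff_rank] at h1
  have h3 := h1 (fun v => c v.1) (funext fun i => by
    rw [Pi.zero_apply, ← hc i, ← Finset.sum_coe_sort s]
    exact Finset.sum_congr rfl fun v _ => mul_comm _ _)
  exact fun v hv => congrFun h3 ⟨v, hv⟩

/-- A linear map can be prescribed on the homogeneous coordinates of `d + 1` generic points. -/
theorem Generic.exists_mulVec_hat {p : Realization V d} (hp : Generic p)
    {s : Finset V} (hs : s.card = d + 1) (y : V → Fin (d + 1) → ℝ) :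
    ∃ M : Matrix (Fin (d + 1)) (Fin (d + 1)) ℝ, ∀ v ∈ s, M.mulVec (hat (p v)) = y v := by
  have hind : LinearIndependent ℝ fun v : s => hat (p v.1) := by
    classical
    rw [Fintype.linearIndependent_iff]
    intro g hg v
    have := hp.hat_linearIndependent hs (fun v => if h : v ∈ s then g ⟨v, h⟩ else 0) (fun i => by
      rw [← Finset.sum_coe_sort s]
      simpa using congrFun hg i) v.1 v.2
    simpa using this
  have : Nonempty s := by
    rw [← Fintype.card_pos_iff]
    simp [hs]
  let b := basisOfLinearIndependentOfCardEqFinrank (b := _) hind (by simp [hs])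
  refine ⟨LinearMap.toMatrix' (b.constr ℝ fun v : s => y v.1), fun v hv => ?_⟩
  rw [LinearMap.toMatrix'_mulVec]
  have : hat (p v) = b ⟨v, hv⟩ := by simp [b]
  rw [this, Basis.constr_basis]

/-! ### Infinitesimal and local rigidity -/

section
variable {V : Type*} {d : ℕ}

/-- `x` is an infinitesimal motion of the framework `H(q)`: to first order, moving each vertex `u`
with velocity `x u` preserves the lengths of the edges. -/
def IsInfMotion (H : SimpleGraph V) (q x : Realization V d) : Prop :=
  ∀ u v, H.Adj u v → inner ℝ (q u - q v) (x u - x v) = 0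

/-- Every infinitesimal motion of `H(q)` preserves all pairwise distances to first order. -/
def InfinitesimallyRigid (H : SimpleGraph V) (q : Realization V d) : Prop :=
  ∀ x, IsInfMotion H q x → IsInfMotion ⊤ q x

theorem IsInfMotion.mono {G H : SimpleGraph V} (h : G ≤ H) {q x : Realization V d}
    (hx : IsInfMotion H q x) : IsInfMotion G q x := fun u v huv => hx u v (h huv)

/-- The averaging principle: `p` and `q` have the same edge lengths exactly when `p - q` is an
infinitesimal motion of the averaged framework (up to scale) `p + q`. -/
theorem sameLengths_iff_isInfMotion (H : SimpleGraph V) (p q : Realization V d) :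
    SameLengths H p q ↔ IsInfMotion H (p + q) (p - q) := by
  refine forall_congr' fun u => forall_congr' fun v => forall_congr' fun _ => ?_
  have h : inner ℝ ((p + q) u - (p + q) v) ((p - q) u - (p - q) v) =
      dist (p u) (p v) ^ 2 - dist (q u) (q v) ^ 2 := by
    rw [dist_eq_norm, dist_eq_norm, ← real_inner_self_eq_norm_sq, ← real_inner_self_eq_norm_sq]
    have h1 : (p + q) u - (p + q) v = (p u - p v) + (q u - q v) := by
      simp only [Pi.add_apply]; abel
    have h2 : (p - q) u - (p - q) v = (p u - p v) - (q u - q v) := by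
      simp only [Pi.sub_apply]; abel
    rw [h1, h2]
    generalize p u - p v = a, q u - q v = b
    rw [inner_add_left, inner_sub_right, inner_sub_right, real_inner_comm a b]
    ring
  rw [h, sub_eq_zero, sq_eq_sq₀ dist_nonneg dist_nonneg]

/-- The rigidity map at `q` of the pairs of vertices `e i`, half of the derivative of their squared
distances. -/
noncomputable def edgeMap {ι : Type*} (e : ι → V × V) (q : Realization V d) :
    Realization V d →ₗ[ℝ] (ι → ℝ) where
  toFun x i := inner ℝ (q (e i).1 - q (e i).2) (x (e i).1 - x (e i).2)
  map_add' x y := by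
    funext i
    simp only [Pi.add_apply, ← inner_add_right]
    congr 1; abel
  map_smul' t x := by
    funext i
    simp only [Pi.smul_apply, ← smul_sub, inner_smul_right, RingHom.id_apply, smul_eq_mul]

theorem edgeMap_apply {ι : Type*} (e : ι → V × V) (q x : Realization V d) (i : ι) :
    edgeMap e q x i = inner ℝ (q (e i).1 - q (e i).2) (x (e i).1 - x (e i).2) := rfl

/-- The edges of a graph, in both orientations. -/
def orientedEdges (H : SimpleGraph V) : {e : V × V // H.Adj e.1 e.2} → V × V := Subtype.val

theorem mem_ker_edgeMap_orientedEdges (H : SimpleGraph V) (q x : Realization V d) :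
    x ∈ LinearMap.ker (edgeMap (orientedEdges H) q) ↔ IsInfMotion H q x := by
  rw [LinearMap.mem_ker, funext_iff]
  exact ⟨fun h u v huv => h ⟨(u, v), huv⟩, fun h i => h _ _ i.2⟩

/-- The rank of the rigidity map. -/
noncomputable def edgeRank {ι : Type*} (e : ι → V × V) (q : Realization V d) : ℕ :=
  finrank ℝ (LinearMap.range (edgeMap e q))

variable {ι : Type*} [Fintype V]

/-- The matrix of the rigidity map over any ring containing the coordinates. -/
noncomputable def rigidityMatrix {R : Type*} [CommRing R] [DecidableEq V] (e : ι → V × V)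
    (z : V × Fin d → R) :
    Matrix ι (V × Fin d) R :=
  Matrix.of fun i y => (z ((e i).1, y.2) - z ((e i).2, y.2)) *
    ((if (e i).1 = y.1 then 1 else 0) - (if (e i).2 = y.1 then 1 else 0))

theorem rigidityMatrix_mulVec [DecidableEq V] (e : ι → V × V) (q x : Realization V d) :
    (rigidityMatrix e fun y : V × Fin d => q y.1 y.2).mulVec (fun y => x y.1 y.2) =
      edgeMap e q x := by
  funext i
  rw [edgeMap_apply, PiLp.inner_apply, Matrix.mulVec, dotProduct, Fintype.sum_prod_type,
    Finset.sum_comm]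
  refine Finset.sum_congr rfl fun k _ => ?_
  simp [rigidityMatrix, mul_assoc, sub_mul, ← Finset.mul_sum]
  ring

theorem edgeRank_eq_rank [Fintype ι] [DecidableEq V] (e : ι → V × V) (q : Realization V d) :
    edgeRank e q = (rigidityMatrix e fun y : V × Fin d => q y.1 y.2).rank := by
  suffices h : LinearMap.range (edgeMap e q) = LinearMap.range
      (rigidityMatrix e fun y : V × Fin d => q y.1 y.2).mulVecLin by
    rw [edgeRank, Matrix.rank, h]
  ext z
  simp only [LinearMap.mem_range, Matrix.mulVecLin_apply]
  constructor
  · rintro ⟨x, rfl⟩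
    exact ⟨_, rigidityMatrix_mulVec e q x⟩
  · rintro ⟨x, rfl⟩
    exact ⟨fun v => WithLp.toLp 2 fun k => x (v, k),
      (rigidityMatrix_mulVec e q fun v => WithLp.toLp 2 fun k => x (v, k)).symm⟩

theorem Generic.edgeRank_le [Fintype ι] {p : Realization V d} (hp : Generic p) (e : ι → V × V)
    (q : Realization V d) : edgeRank e q ≤ edgeRank e p := by
  classical
  have h : ∀ r : Realization V d, (rigidityMatrix e fun y : V × Fin d => r y.1 y.2) =
      (rigidityMatrix e (MvPolynomial.X (R := ℚ))).map
        (MvPolynomial.aeval fun y : V × Fin d => r y.1 y.2) := by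
    intro r
    ext i y
    simp only [rigidityMatrix, Matrix.map_apply, Matrix.of_apply, map_mul, map_sub,
      MvPolynomial.aeval_X]
    congr 2 <;> split_ifs <;> simp
  rw [edgeRank_eq_rank, edgeRank_eq_rank, h, h]
  exact rank_map_aeval_le _ hp _

/-- The rank of the rigidity map depends only on the distances: it is the rank of the Gram matrix
of the rows, whose entries are inner products of differences of points. -/
theorem edgeRank_eq_of_congruent [Fintype ι] (e : ι → V × V) {p q : Realization V d}
    (h : Congruent p q) :
    edgeRank e p = edgeRank e q := by
  classical
  have hd : ∀ u v, dist (p u) (p v) = dist (q u) (q v) := fun u v => by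
    by_cases huv : u = v
    · simp [huv]
    · exact h u v huv
  have hin : ∀ a b c f : V, inner ℝ (p a - p b) (p c - p f) = inner ℝ (q a - q b) (q c - q f) := by
    have key : ∀ (r : Realization V d) (a b c f : V), inner ℝ (r a - r b) (r c - r f) =
        (dist (r a) (r f) ^ 2 + dist (r b) (r c) ^ 2 - dist (r a) (r c) ^ 2 -
          dist (r b) (r f) ^ 2) / 2 := by
      intro r a b c f
      simp only [dist_eq_norm, ← real_inner_self_eq_norm_sq, inner_sub_left, inner_sub_right]
      rw [real_inner_comm (r a) (r f), real_inner_comm (r b) (r c), real_inner_comm (r a) (r c),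
        real_inner_comm (r b) (r f)]
      ring
    intro a b c f
    rw [key, key, hd, hd, hd, hd]
  let α : ι → V → ℝ := fun i v => (if (e i).1 = v then 1 else 0) - (if (e i).2 = v then 1 else 0)
  have hG : ∀ (r : Realization V d) (i j : ι),
      ((rigidityMatrix e fun y : V × Fin d => r y.1 y.2) *
        (rigidityMatrix e fun y : V × Fin d => r y.1 y.2).transpose) i j =
      inner ℝ (r (e i).1 - r (e i).2) (r (e j).1 - r (e j).2) * ∑ v, α i v * α j v := by
    intro r i j
    rw [Matrix.mul_apply, Fintype.sum_prod_type, PiLp.inner_apply, Finset.sum_mul_sum,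
      Finset.sum_comm]
    refine Finset.sum_congr rfl fun k _ => Finset.sum_congr rfl fun v _ => ?_
    simp only [rigidityMatrix, Matrix.transpose_apply, Matrix.of_apply, PiLp.sub_apply,
      RCLike.inner_apply, conj_trivial, α]
    ring
  rw [edgeRank_eq_rank, edgeRank_eq_rank, ← Matrix.rank_self_mul_transpose,
    ← Matrix.rank_self_mul_transpose (rigidityMatrix e fun y : V × Fin d => q y.1 y.2)]
  congr 1
  ext i j
  rw [hG, hG, hin]

theorem continuous_edgeMap [Fintype ι] (e : ι → V × V) :
    Continuous fun q : Realization V d => LinearMap.toContinuousLinearMap (edgeMap e q) := by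
  rw [continuous_clm_apply]
  intro x
  refine continuous_pi fun i => ?_
  simp only [LinearMap.coe_toContinuousLinearMap', edgeMap_apply]
  fun_prop

theorem isOpen_le_edgeRank [Fintype ι] (e : ι → V × V) (r : ℕ) :
    IsOpen {q : Realization V d | r ≤ edgeRank e q} := by
  have h := (isOpen_setOfPred_nat_le_rank (𝕜 := ℝ) (E := Realization V d) (F := ι → ℝ) r).preimage
    (continuous_edgeMap e)
  convert h using 1
  ext q
  have h1 : ((edgeRank e q : ℕ) : Cardinal) = (edgeMap e q).rank := finrank_eq_rank _ _
  change r ≤ edgeRank e q ↔ (r : Cardinal) ≤ (edgeMap e q).rank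
  rw [← h1, Nat.cast_le]

theorem ker_edgeMap_le {ι' : Type*} (e : ι → V × V) (e' : ι' → V × V)
    {q : Realization V d}
    (hker : LinearMap.ker (edgeMap e' q) ≤ LinearMap.ker (edgeMap e q))
    (hrank : edgeRank e' q ≤ edgeRank e q) :
    LinearMap.ker (edgeMap e q) ≤ LinearMap.ker (edgeMap e' q) := by
  have h1 := LinearMap.finrank_range_add_finrank_ker (edgeMap e q)
  have h2 := LinearMap.finrank_range_add_finrank_ker (edgeMap e' q)
  unfold edgeRank at hrank
  exact (Submodule.eq_of_le_of_finrank_le hker (by omega)).ge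

theorem InfinitesimallyRigid.edgeRank_eq {H : SimpleGraph V} {p : Realization V d}
    (h : InfinitesimallyRigid H p) :
    edgeRank (orientedEdges ⊤) p = edgeRank (orientedEdges H) p := by
  have hk : LinearMap.ker (edgeMap (orientedEdges ⊤) p) =
      LinearMap.ker (edgeMap (orientedEdges H) p) := by
    ext x
    rw [mem_ker_edgeMap_orientedEdges, mem_ker_edgeMap_orientedEdges]
    exact ⟨fun hx => hx.mono le_top, h x⟩
  have h1 := LinearMap.finrank_range_add_finrank_ker (edgeMap (orientedEdges H) p)
  have h2 := LinearMap.finrank_range_add_finrank_ker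
    (edgeMap (orientedEdges (⊤ : SimpleGraph V)) p)
  rw [hk] at h2
  unfold edgeRank
  omega

/-- At a generic realization the rank of the complete graph is maximal, so every realization at
which the rank of `H` does not drop is again infinitesimally rigid. -/
theorem InfinitesimallyRigid.of_edgeRank_le {H : SimpleGraph V} {p q : Realization V d}
    [Fintype {e : V × V // H.Adj e.1 e.2}]
    (hp : Generic p) (h : InfinitesimallyRigid H p)
    (hq : edgeRank (orientedEdges H) p ≤ edgeRank (orientedEdges H) q) :
    InfinitesimallyRigid H q := by
  classical
  intro x hx
  rw [← mem_ker_edgeMap_orientedEdges] at hx ⊢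
  refine ker_edgeMap_le (orientedEdges H) (orientedEdges ⊤) (fun y hy => ?_) ?_ hx
  · rw [mem_ker_edgeMap_orientedEdges] at hy ⊢
    exact hy.mono le_top
  · exact (hp.edgeRank_le _ q).trans (h.edgeRank_eq.le.trans hq)

/-- The times at which a flexing is congruent to the original framework form an open and closed
set; it is open because, by averaging, two nearby realizations of an infinitesimally rigid
framework with the same edge lengths are congruent. -/
theorem InfinitesimallyRigid.locallyRigid {H : SimpleGraph V} {p : Realization V d}
    (hp : Generic p) (h : InfinitesimallyRigid H p) : LocallyRigid H p := by
  classical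
  rintro γ ⟨hγ, hγ0, hlen⟩
  set O : Set (Realization V d) :=
    {q | edgeRank (orientedEdges H) p ≤ edgeRank (orientedEdges H) q} with hO
  have hOopen : IsOpen O := isOpen_le_edgeRank _ _
  have hcont : Continuous γ := hγ.continuous
  have htrans : ∀ {a b c : Realization V d}, Congruent a b → Congruent b c → Congruent a c :=
    fun h1 h2 u v huv => (h1 u v huv).trans (h2 u v huv)
  have hclosed : IsClosed {t | Congruent p (γ t)} := by
    simp only [Congruent, SameLengths, Set.ofPred_forall]
    refine isClosed_iInter fun u => isClosed_iInter fun v => isClosed_iInter fun _ => ?_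
    exact isClosed_eq continuous_const (by fun_prop)
  have hopen : IsOpen {t | Congruent p (γ t)} := by
    rw [isOpen_iff_mem_nhds]
    intro t₀ ht₀
    have hmem : γ t₀ ∈ O := (edgeRank_eq_of_congruent _ ht₀).le
    have hmid : Continuous fun t => (1 / 2 : ℝ) • (γ t₀ + γ t) := by fun_prop
    have hmem' : (1 / 2 : ℝ) • (γ t₀ + γ t₀) ∈ O := by
      rwa [← two_smul ℝ (γ t₀), smul_smul, show (1 / 2 : ℝ) * 2 = 1 by norm_num, one_smul]
    filter_upwards [hmid.continuousAt (hOopen.mem_nhds hmem')] with t ht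
    refine htrans ht₀ ?_
    have hrig : InfinitesimallyRigid H ((1 / 2 : ℝ) • (γ t₀ + γ t)) := h.of_edgeRank_le hp ht
    have hscale : ∀ K : SimpleGraph V, IsInfMotion K ((1 / 2 : ℝ) • (γ t₀ + γ t)) (γ t₀ - γ t) ↔
        IsInfMotion K (γ t₀ + γ t) (γ t₀ - γ t) := by
      intro K
      refine forall_congr' fun u => forall_congr' fun v => forall_congr' fun _ => ?_
      simp only [Pi.smul_apply, ← smul_sub, inner_smul_left]
      simp
    have h1 : SameLengths H (γ t₀) (γ t) := fun u v huv =>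
      (hlen t₀ u v huv).symm.trans (hlen t u v huv)
    rw [sameLengths_iff_isInfMotion, ← hscale] at h1
    rw [Congruent, sameLengths_iff_isInfMotion, ← hscale]
    exact hrig _ h1
  have huniv := IsClopen.eq_univ ⟨hclosed, hopen⟩
    ⟨0, by rw [Set.mem_ofPred_eq, hγ0]; intro u v _; rfl⟩
  intro t
  exact (Set.eq_univ_iff_forall.1 huniv t)

end

/-! ### Infinitesimal rigidity of bipartite frameworks by propagation -/

section
variable {V : Type*} {d : ℕ}

theorem hat_dotProduct_cons (p x : Realization V d) (u v : V) (α : ℝ) :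
    (Fin.cons α (fun k => x u k) : Fin (d + 1) → ℝ) ⬝ᵥ hat (p v) = α + inner ℝ (x u) (p v) := by
  rw [dotProduct, Fin.sum_univ_succ, PiLp.inner_apply]
  simp [mul_comm]

/-- The homogeneous velocities `y_u = (-⟪x_u, p_u⟫, x_u)` turn the condition that `x` preserves
the length of an edge to first order into a bilinear one. -/
theorem inner_sub_sub_eq_dotProduct_hat (p x : Realization V d) (u v : V) :
    inner ℝ (p u - p v) (x u - x v) =
      -((Fin.cons (-inner ℝ (x u) (p u)) (fun k => x u k) : Fin (d + 1) → ℝ) ⬝ᵥ hat (p v) +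
        (Fin.cons (-inner ℝ (x v) (p v)) (fun k => x v k) : Fin (d + 1) → ℝ) ⬝ᵥ hat (p u)) := by
  rw [hat_dotProduct_cons, hat_dotProduct_cons]
  simp only [inner_sub_left, inner_sub_right]
  rw [real_inner_comm (x u) (p u), real_inner_comm (x v) (p v), real_inner_comm (x v) (p u),
    real_inner_comm (x u) (p v)]
  ring

/-- A bipartite graph on `(d+2 choose 2)` vertices is infinitesimally rigid at generic realizations
as soon as its whole vertex set is generated by `d + 1` vertices of one colour under the rule that a
vertex with `d + 1` generated neighbours is generated.

The homogeneous velocities of an infinitesimal motion agree on the initial vertices with a linear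
map `M`, and the rule propagates this: `y_v = M v̂` on their colour class, `y_v = -Mᵀ v̂` on the
other. Since `y_v` is orthogonal to `v̂`, the quadric of `M` passes through all the points, so `M` is
skew-symmetric and the motion is trivial. -/
theorem Generic.infinitesimallyRigid_of_propagation [Fintype V] {p : Realization V d}
    (hp : Generic p) (hV : Fintype.card V = (d + 2).choose 2) {H : SimpleGraph V}
    (color : V → Bool) (hcolor : ∀ u v, H.Adj u v → color u ≠ color v)
    {s : Finset V} (hs : s.card = d + 1) (hsc : ∀ v ∈ s, color v = true)
    (hgen : ∀ Z : Set V, (∀ v ∈ s, v ∈ Z) →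
      (∀ v, ∀ t : Finset V, d + 1 ≤ t.card → (∀ w ∈ t, H.Adj v w ∧ w ∈ Z) → v ∈ Z) →
      ∀ v, v ∈ Z) :
    InfinitesimallyRigid H p := by
  intro x hx
  set y : V → Fin (d + 1) → ℝ := fun u => Fin.cons (-inner ℝ (x u) (p u)) (fun k => x u k) with hy
  have hpair : ∀ u v, inner ℝ (p u - p v) (x u - x v) =
      -(y u ⬝ᵥ hat (p v) + y v ⬝ᵥ hat (p u)) := inner_sub_sub_eq_dotProduct_hat p x
  have hself : ∀ u, y u ⬝ᵥ hat (p u) = 0 := fun u => by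
    rw [hy, hat_dotProduct_cons]; ring
  obtain ⟨M, hM⟩ := hp.exists_mulVec_hat hs y
  have hMT : ∀ u v, M.transpose.mulVec (hat (p u)) ⬝ᵥ hat (p v) =
      M.mulVec (hat (p v)) ⬝ᵥ hat (p u) := fun u v => by
    rw [Matrix.mulVec_transpose, ← Matrix.dotProduct_mulVec, dotProduct_comm]
  set z : V → Fin (d + 1) → ℝ := fun u =>
    if color u then y u - M.mulVec (hat (p u)) else y u + M.transpose.mulVec (hat (p u)) with hz
  have hzt : ∀ u, color u = true → z u = y u - M.mulVec (hat (p u)) := fun u h => by simp [hz, h]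
  have hzf : ∀ u, color u = false → z u = y u + M.transpose.mulVec (hat (p u)) := fun u h => by
    simp [hz, h]
  have hzpair : ∀ u v, H.Adj u v → z u ⬝ᵥ hat (p v) + z v ⬝ᵥ hat (p u) = 0 := by
    intro u v huv
    have h0 : y u ⬝ᵥ hat (p v) + y v ⬝ᵥ hat (p u) = 0 := by
      linarith [hpair u v, hx u v huv]
    have hne := hcolor u v huv
    cases hu : color u <;> cases hv : color v
    · exact absurd (hu.trans hv.symm) hne
    · rw [hzf u hu, hzt v hv, add_dotProduct, sub_dotProduct, hMT]; linarith
    · rw [hzt u hu, hzf v hv, add_dotProduct, sub_dotProduct, hMT]; linarith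
    · exact absurd (hu.trans hv.symm) hne
  have hzero : ∀ v, z v = 0 := by
    refine hgen {v | z v = 0} (fun v hv => ?_) fun v t ht h => ?_
    · change z v = 0
      rw [hzt v (hsc v hv), hM v hv, sub_self]
    · refine hp.eq_zero_of_dotProduct_hat ht (z v) fun w hw => ?_
      have h1 := hzpair v w (h w hw).1
      rwa [show z w = 0 from (h w hw).2, zero_dotProduct, add_zero] at h1
  have hquad : ∀ u, M.mulVec (hat (p u)) ⬝ᵥ hat (p u) = 0 := by
    intro u
    have h1 := hself u
    have h2 := congrArg (· ⬝ᵥ hat (p u)) (hzero u)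
    cases hu : color u
    · simp only [hzf u hu, add_dotProduct, zero_dotProduct, hMT] at h2; linarith
    · simp only [hzt u hu, sub_dotProduct, zero_dotProduct] at h2; linarith
  have hskew : ∀ i j, M i j + M j i = 0 := by
    let c : Sym2 (Fin (d + 1)) → ℝ := Sym2.lift ⟨fun i j => M i j + M j i, fun i j => add_comm _ _⟩
    have hc : c = 0 := by
      refine hp.quadForm_injective hV c fun v => ?_
      have h1 : ∑ i, ∑ j, M i j * hat (p v) i * hat (p v) j = 0 := by
        rw [← hquad v]
        simp only [Matrix.mulVec, dotProduct, Finset.sum_mul]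
        exact Finset.sum_congr rfl fun i _ => Finset.sum_congr rfl fun j _ => by ring
      have h2 : ∑ i, ∑ j, M j i * hat (p v) i * hat (p v) j = 0 := by
        rw [Finset.sum_comm, ← h1]
        exact Finset.sum_congr rfl fun i _ => Finset.sum_congr rfl fun j _ => by ring
      simp only [quadForm, c, Sym2.lift_mk, add_mul, Finset.sum_add_distrib, h1, h2, add_zero]
    intro i j
    exact congrFun hc s(i, j)
  have hMT' : M.transpose = -M := by
    ext i j
    simp only [Matrix.transpose_apply, Matrix.neg_apply]
    linarith [hskew i j]
  have hyM : ∀ v, y v = M.mulVec (hat (p v)) := by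
    intro v
    have h := hzero v
    cases hv : color v
    · rw [hzf v hv, hMT', Matrix.neg_mulVec, ← sub_eq_add_neg] at h
      exact sub_eq_zero.1 h
    · rw [hzt v hv] at h
      exact sub_eq_zero.1 h
  intro u v _
  have h := hMT u v
  rw [hMT', Matrix.neg_mulVec, neg_dotProduct] at h
  rw [hpair, hyM, hyM]
  linarith

end

/-! ### Chains with large inner parts are redundantly rigid -/

section
variable {k : ℕ} {a : Fin k → ℕ} {d : ℕ}

/-- The `i`-th part of the vertex set of a chain. -/
def part (a : Fin k → ℕ) (i : Fin k) : Finset (Σ i : Fin k, Fin (a i)) :=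
  Finset.univ.map ⟨Sigma.mk i, sigma_mk_injective⟩

theorem mem_part {i : Fin k} {v : Σ i : Fin k, Fin (a i)} : v ∈ part a i ↔ v.1 = i := by
  constructor
  · intro h
    obtain ⟨x, _, rfl⟩ := Finset.mem_map.1 h
    rfl
  · rintro rfl
    exact Finset.mem_map.2 ⟨v.2, Finset.mem_univ _, rfl⟩

theorem card_part (i : Fin k) : (part a i).card = a i := by simp [part]

theorem chain_adj {u v : Σ i : Fin k, Fin (a i)} :
    (chain a).Adj u v ↔ u.1.val + 1 = v.1.val ∨ v.1.val + 1 = u.1.val := Iff.rfl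

/-- A chain from which one edge has been removed, one of whose ends lies in an inner part with at
least `d + 2` vertices, is still infinitesimally rigid. -/
theorem Generic.infinitesimallyRigid_chain_deleteEdges
    {p : Realization (Σ i : Fin k, Fin (a i)) d} (hp : Generic p) (hk : 4 ≤ k) (ha : ∀ i, 0 < a i)
    (hv : ∑ i, a i = (d + 2).choose 2)
    (hinner : ∀ i : Fin k, 1 ≤ i.val → i.val ≤ k - 2 → d + 1 ≤ a i)
    {u₀ v₀ : Σ i : Fin k, Fin (a i)} (huv : (chain a).Adj u₀ v₀)
    (h1 : 1 ≤ v₀.1.val) (h2 : v₀.1.val ≤ k - 2) (hlarge : d + 2 ≤ a v₀.1) :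
    InfinitesimallyRigid ((chain a).deleteEdges {s(u₀, v₀)}) p := by
  classical
  set j := v₀.1 with hj
  have hadj : ∀ u v, (chain a).Adj u v → u ≠ v₀ → v ≠ v₀ →
      ((chain a).deleteEdges {s(u₀, v₀)}).Adj u v := by
    intro u v h hu hv
    rw [SimpleGraph.deleteEdges_adj]
    refine ⟨h, fun h' => ?_⟩
    rcases Sym2.eq_iff.1 (Set.mem_singleton_iff.1 h') with ⟨_, h⟩ | ⟨h, _⟩
    · exact hv h
    · exact hu h
  have hadj' : ∀ w, (chain a).Adj v₀ w → w ≠ u₀ →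
      ((chain a).deleteEdges {s(u₀, v₀)}).Adj v₀ w := by
    intro w h hw
    rw [SimpleGraph.deleteEdges_adj]
    refine ⟨h, fun h' => ?_⟩
    rcases Sym2.eq_iff.1 (Set.mem_singleton_iff.1 h') with ⟨h1, h2⟩ | ⟨_, h⟩
    · exact huv.ne h1.symm
    · exact hw h
  obtain ⟨s, hsub, hs⟩ : ∃ s ⊆ (part a j).erase v₀, s.card = d + 1 := by
    refine Finset.exists_subset_card_eq ?_
    rw [Finset.card_erase_of_mem (mem_part.2 hj.symm), card_part]
    exact Nat.le_sub_of_add_le hlarge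
  have hsmem : ∀ w ∈ s, w ≠ v₀ ∧ w.1 = j := fun w hw =>
    ⟨(Finset.mem_erase.1 (hsub hw)).1, mem_part.1 (Finset.mem_erase.1 (hsub hw)).2⟩
  have hcard : Fintype.card (Σ i : Fin k, Fin (a i)) = (d + 2).choose 2 := by simpa using hv
  refine hp.infinitesimallyRigid_of_propagation hcard
    (fun v => decide (v.1.val % 2 = j.val % 2)) ?_ hs ?_ ?_
  · intro u v huv' heq
    have h := (SimpleGraph.deleteEdges_adj.1 huv').1
    rw [chain_adj] at h
    rw [decide_eq_decide] at heq
    omega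
  · intro v hv'
    simp [(hsmem v hv').2]
  intro Z hsZ hZ
  let jm : Fin k := ⟨j.val - 1, by omega⟩
  let jp : Fin k := ⟨j.val + 1, by omega⟩
  have hnear : ∀ v : Σ i : Fin k, Fin (a i), v.1 = jm ∨ v.1 = jp → v ∈ Z := by
    intro v hvj
    have hval : v.1.val = j.val - 1 ∨ v.1.val = j.val + 1 := by
      rcases hvj with h | h <;> simp [h, jm, jp]
    refine hZ v s hs.ge fun w hw => ⟨hadj v w ?_ ?_ (hsmem w hw).1, hsZ w hw⟩
    · rw [chain_adj, (hsmem w hw).2]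
      omega
    · rintro rfl
      rw [← hj] at hval
      omega
  have hnbr : ∀ w ∈ part a jm ∪ part a jp, w ∈ Z ∧ ∀ v : Σ i : Fin k, Fin (a i), v.1 = j →
      (chain a).Adj v w := by
    intro w hw
    rw [Finset.mem_union, mem_part, mem_part] at hw
    refine ⟨hnear w hw, fun v hvj => ?_⟩
    rw [chain_adj, hvj]
    rcases hw with h | h <;> simp [h, jm, jp]
    omega
  -- one of the two neighbouring parts is an inner part, and the other one is nonempty
  have hnbrcard : d + 2 ≤ (part a jm ∪ part a jp).card := by
    rw [Finset.card_union_of_disjoint, card_part, card_part]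
    · have hm := ha jm
      have hp' := ha jp
      by_cases hj1 : j.val = 1
      · have := hinner jp (by simp [jp]) (by simp only [jp]; omega)
        omega
      · have := hinner jm (by simp only [jm]; omega) (by simp only [jm]; omega)
        omega
    · rw [Finset.disjoint_left]
      intro v hv1 hv2
      rw [mem_part] at hv1 hv2
      have := congrArg Fin.val (hv1.symm.trans hv2)
      simp only [jm, jp] at this
      omega
  have hmid : ∀ v : Σ i : Fin k, Fin (a i), v.1 = j → v ∈ Z := by
    intro v hvj
    by_cases hv0 : v = v₀
    · subst hv0
      refine hZ _ ((part a jm ∪ part a jp).erase u₀) ?_ fun w hw => ?_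
      · have := Finset.pred_card_le_card_erase (s := part a jm ∪ part a jp) (a := u₀)
        omega
      · obtain ⟨hw1, hw2⟩ := Finset.mem_erase.1 hw
        exact ⟨hadj' w ((hnbr w hw2).2 _ rfl) hw1, (hnbr w hw2).1⟩
    · refine hZ v (part a jm ∪ part a jp) (by omega) fun w hw =>
        ⟨hadj v w ((hnbr w hw).2 v hvj) hv0 ?_, (hnbr w hw).1⟩
      rintro rfl
      have := (hnbr _ hw).2 _ hj.symm
      exact this.ne rfl
  have hup : ∀ m : ℕ, ∀ v : Σ i : Fin k, Fin (a i), v.1.val = j.val + 1 + m → v ∈ Z := by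
    intro m
    induction m with
    | zero => exact fun v hvm => hnear v (Or.inr (Fin.ext hvm))
    | succ m ih =>
      intro v hvm
      have := v.1.isLt
      refine hZ v (part a ⟨j.val + 1 + m, by omega⟩) ?_ fun w hw => ?_
      · rw [card_part]
        exact hinner _ (by simp only; omega) (by simp only; omega)
      · have hw' : w.1.val = j.val + 1 + m := congrArg Fin.val (mem_part.1 hw)
        refine ⟨hadj v w ?_ ?_ ?_, ih w hw'⟩
        · rw [chain_adj]; omega
        · rintro rfl; rw [← hj] at hvm; omega
        · rintro rfl; rw [← hj] at hw'; omega
  have hdown : ∀ m : ℕ, ∀ v : Σ i : Fin k, Fin (a i), v.1.val + 1 + m = j.val → v ∈ Z := by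
    intro m
    induction m with
    | zero => exact fun v hvm => hnear v (Or.inl (Fin.ext (by simp only [jm]; omega)))
    | succ m ih =>
      intro v hvm
      refine hZ v (part a ⟨v.1.val + 1, by omega⟩) ?_ fun w hw => ?_
      · rw [card_part]
        exact hinner _ (by simp only; omega) (by simp only; omega)
      · have hw' : w.1.val = v.1.val + 1 := congrArg Fin.val (mem_part.1 hw)
        refine ⟨hadj v w ?_ ?_ ?_, ih w (by omega)⟩
        · rw [chain_adj]; omega
        · rintro rfl; rw [← hj] at hvm; omega
        · rintro rfl; rw [← hj] at hw'; omega
  intro v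
  rcases lt_trichotomy v.1.val j.val with h | h | h
  · exact hdown (j.val - v.1.val - 1) v (by omega)
  · exact hmid v (Fin.ext h)
  · exact hup (v.1.val - j.val - 1) v (by omega)

/-- A chain in which every inner part has at least `d + 1` vertices, the second and the last but
one at least `d + 2`, and no two consecutive parts exactly `d + 1`, is redundantly rigid: every edge
has an end in an inner part with at least `d + 2` vertices. -/
theorem genericallyRedundantlyRigid_chain (hk : 4 ≤ k) (ha : ∀ i, 0 < a i)
    (hv : ∑ i, a i = (d + 2).choose 2)
    (hinner : ∀ i : Fin k, 1 ≤ i.val → i.val ≤ k - 2 → d + 1 ≤ a i)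
    (hfirst : d + 2 ≤ a ⟨1, by omega⟩) (hlast : d + 2 ≤ a ⟨k - 2, by omega⟩)
    (hcons : ¬ ∃ i j : Fin k, j.val = i.val + 1 ∧ a i = d + 1 ∧ a j = d + 1) :
    GenericallyRedundantlyRigid (chain a) d := by
  intro p hp e he
  refine InfinitesimallyRigid.locallyRigid hp ?_
  have key : ∀ u v : Σ i : Fin k, Fin (a i), u.1.val + 1 = v.1.val →
      InfinitesimallyRigid ((chain a).deleteEdges {s(u, v)}) p := by
    intro u v huv
    have hlt := v.1.isLt
    by_cases hcase : v.1.val ≤ k - 2 ∧ d + 2 ≤ a v.1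
    · exact hp.infinitesimallyRigid_chain_deleteEdges hk ha hv hinner (Or.inl huv) (by omega)
        hcase.1 hcase.2
    · rw [Sym2.eq_swap]
      have h1 : 1 ≤ u.1.val := by
        by_contra h
        refine hcase ⟨by omega, ?_⟩
        rwa [show v.1 = ⟨1, by omega⟩ from Fin.ext (by simp only; omega)]
      refine hp.infinitesimallyRigid_chain_deleteEdges hk ha hv hinner (Or.inr huv) h1 (by omega) ?_
      by_cases hv2 : v.1.val ≤ k - 2
      · have hu := hinner u.1 h1 (by omega)
        have hv' := hinner v.1 (by omega) hv2
        by_contra hu'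
        exact hcons ⟨u.1, v.1, huv.symm, by omega, by omega⟩
      · rwa [show u.1 = ⟨k - 2, by omega⟩ from Fin.ext (by simp only; omega)]
  induction e using Sym2.ind with
  | _ u v =>
    rcases chain_adj.1 ((SimpleGraph.mem_edgeSet _).1 he) with h | h
    · exact key u v h
    · rw [Sym2.eq_swap]; exact key v u h

end

/-! ### Bipartite graphs on few vertices are not globally rigid -/

section
variable {V : Type*} {d : ℕ}

/-- Half the gradient at `x` of the quadric with coefficients `c`. -/
noncomputable def halfGrad (c : Sym2 (Fin (d + 1)) → ℝ) (x : EuclideanSpace ℝ (Fin d)) :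
    EuclideanSpace ℝ (Fin d) :=
  WithLp.toLp 2 fun k => ∑ j, c s(k.succ, j) * hat x j

theorem halfGrad_apply (c : Sym2 (Fin (d + 1)) → ℝ) (x : EuclideanSpace ℝ (Fin d)) (k : Fin d) :
    halfGrad c x k = ∑ j, c s(k.succ, j) * hat x j := rfl

/-- A difference of values of a quadric, as an inner product with a sum of gradients. -/
theorem inner_sub_halfGrad_add (c : Sym2 (Fin (d + 1)) → ℝ) (x y : EuclideanSpace ℝ (Fin d)) :
    inner ℝ (x - y) (halfGrad c x + halfGrad c y) = quadForm c (hat x) - quadForm c (hat y) := by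
  have hsym : ∑ i, ∑ j, c s(i, j) * hat x i * hat y j =
      ∑ i, ∑ j, c s(i, j) * hat y i * hat x j := by
    rw [Finset.sum_comm]
    refine Finset.sum_congr rfl fun i _ => Finset.sum_congr rfl fun j _ => ?_
    rw [Sym2.eq_swap]; ring
  have h1 : quadForm c (hat x) - quadForm c (hat y) =
      ∑ i, (hat x i - hat y i) * ∑ j, c s(i, j) * (hat x j + hat y j) := by
    have : ∑ i, (hat x i - hat y i) * ∑ j, c s(i, j) * (hat x j + hat y j) =
        quadForm c (hat x) - quadForm c (hat y) +
          (∑ i, ∑ j, c s(i, j) * hat x i * hat y j - ∑ i, ∑ j, c s(i, j) * hat y i * hat x j) := by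
      simp only [quadForm, ← Finset.sum_sub_distrib, ← Finset.sum_add_distrib, Finset.mul_sum]
      exact Finset.sum_congr rfl fun i _ => Finset.sum_congr rfl fun j _ => by ring
    rw [this, hsym]; ring
  rw [h1, Fin.sum_univ_succ, PiLp.inner_apply]
  simp only [hat_zero, sub_self, zero_mul, zero_add, hat_succ]
  refine Finset.sum_congr rfl fun k _ => ?_
  simp only [PiLp.sub_apply, PiLp.add_apply, halfGrad_apply, RCLike.inner_apply, conj_trivial,
    ← Finset.sum_add_distrib, ← mul_add]
  ring

theorem inner_halfGrad (c : Sym2 (Fin (d + 1)) → ℝ) (x : EuclideanSpace ℝ (Fin d)) :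
    inner ℝ x (halfGrad c x) =
      ∑ k, c s(0, k.succ) * x k + ∑ k, ∑ l, c s(k.succ, l.succ) * x k * x l := by
  rw [PiLp.inner_apply, ← Finset.sum_add_distrib]
  refine Finset.sum_congr rfl fun k _ => ?_
  simp only [halfGrad_apply, RCLike.inner_apply, conj_trivial, Fin.sum_univ_succ, hat_zero,
    hat_succ, mul_one, add_mul, Finset.sum_mul]
  rw [Sym2.eq_swap]
  congr 1
  exact Finset.sum_congr rfl fun l _ => by ring

/-- The sign attached to a colour, `1` for `true` and `-1` for `false`. -/
def sgn (b : Bool) : ℝ := if b then 1 else -1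

theorem sgn_eq_neg {b b' : Bool} (h : b ≠ b') : sgn b' = -sgn b := by
  cases b <;> cases b' <;> simp_all [sgn]

/-- From coefficients `c` of a quadric and points `x`: the values of the quadric at the points, and
the points displaced along its gradient, forwards or backwards according to their colour. -/
noncomputable def displace (color : V → Bool)
    (z : (Sym2 (Fin (d + 1)) → ℝ) × Realization V d) : (V → ℝ) × Realization V d :=
  (fun v => quadForm z.1 (hat (z.2 v)), fun v => z.2 v + sgn (color v) • halfGrad z.1 (z.2 v))

/-- If the points lie on the quadric, displacing them in one or in the other direction gives two
realizations with the same edge lengths. -/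
theorem sameLengths_displace {H : SimpleGraph V} {color : V → Bool}
    (hcolor : ∀ u v, H.Adj u v → color u ≠ color v) (c : Sym2 (Fin (d + 1)) → ℝ)
    (x : Realization V d) (hx : ∀ v, quadForm c (hat (x v)) = 0) :
    SameLengths H (fun v => x v + sgn (color v) • halfGrad c (x v))
      (fun v => x v - sgn (color v) • halfGrad c (x v)) := by
  rw [sameLengths_iff_isInfMotion]
  intro u v huv
  have h1 : ∀ w, (fun v => x v + sgn (color v) • halfGrad c (x v)) w +
      (fun v => x v - sgn (color v) • halfGrad c (x v)) w = (2 : ℝ) • x w := fun w => by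
    simp only; module
  have h2 : ∀ w, (fun v => x v + sgn (color v) • halfGrad c (x v)) w -
      (fun v => x v - sgn (color v) • halfGrad c (x v)) w =
        (2 * sgn (color w)) • halfGrad c (x w) := fun w => by
    simp only; module
  simp only [Pi.add_apply, Pi.sub_apply] at h1 h2 ⊢
  rw [h1, h1, h2, h2, sgn_eq_neg (hcolor u v huv)]
  have h3 : (2 * sgn (color u)) • halfGrad c (x u) - (2 * -sgn (color u)) • halfGrad c (x v) =
      (2 * sgn (color u)) • (halfGrad c (x u) + halfGrad c (x v)) := by module
  rw [h3, ← smul_sub, inner_smul_left, inner_smul_right, inner_sub_halfGrad_add, hx, hx]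
  simp

/-! ### The derivative at points of a sphere -/

/-- The derivative of `displace` at points `x` of the unit sphere vanishes on a perturbation `c` of
the coefficients and `η` of the points if `Q_c(x) + ⟪x, η⟫ = 0` and `η = -ε (grad + η / 2)` for each
point, where `Q_c` is the quadric of `c`, `grad` half its gradient, and `ε` the sign of the colour.
Eliminating `η` leaves this functional of `c`, namely `Q_c(x) - (ε / (1 + ε / 2)) ⟪x, grad⟫`. -/
noncomputable def sphereFunctional (b : Bool) (x : EuclideanSpace ℝ (Fin d)) :
    (Sym2 (Fin (d + 1)) → ℝ) →ₗ[ℝ] ℝ where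
  toFun c := c s(0, 0) + (if b then 4 / 3 else 4) * ∑ k, c s(0, k.succ) * x k +
    (if b then 1 / 3 else 3) * ∑ k, ∑ l, c s(k.succ, l.succ) * x k * x l
  map_add' c c' := by
    simp only [Pi.add_apply, add_mul, Finset.sum_add_distrib]; ring
  map_smul' t c := by
    simp only [Pi.smul_apply, smul_eq_mul, mul_assoc, ← Finset.mul_sum, RingHom.id_apply]; ring

theorem sphereFunctional_apply (b : Bool) (x : EuclideanSpace ℝ (Fin d))
    (c : Sym2 (Fin (d + 1)) → ℝ) : sphereFunctional b x c =
      c s(0, 0) + (if b then 4 / 3 else 4) * ∑ k, c s(0, k.succ) * x k +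
        (if b then 1 / 3 else 3) * ∑ k, ∑ l, c s(k.succ, l.succ) * x k * x l := rfl

/-- The coefficients of the quadric `∑ x_k ^ 2 + w`. -/
def sphereCoeff (w : ℝ) : Sym2 (Fin (d + 1)) → ℝ :=
  Sym2.lift ⟨fun i j => if i = j then (if i = 0 then w else 1) else 0, fun i j => by
    by_cases h : i = j
    · rw [h]
    · simp only [if_neg h, if_neg (Ne.symm h)]⟩

theorem sphereCoeff_mk (w : ℝ) (i j : Fin (d + 1)) :
    (sphereCoeff w : Sym2 (Fin (d + 1)) → ℝ) s(i, j) =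
      if i = j then (if i = 0 then w else 1) else 0 := rfl

theorem sphereFunctional_single (b : Bool) (k : Fin d) (t : ℝ) (c : Sym2 (Fin (d + 1)) → ℝ) :
    sphereFunctional b (EuclideanSpace.single k t) c = c s(0, 0) +
      (if b then 4 / 3 else 4) * (c s(0, k.succ) * t) +
        (if b then 1 / 3 else 3) * (c s(k.succ, k.succ) * t * t) := by
  simp [sphereFunctional_apply, PiLp.single_apply, mul_ite]

theorem sphereFunctional_sphereCoeff (b : Bool) (k : Fin d) (w : ℝ) :
    sphereFunctional b (EuclideanSpace.single k 1) (sphereCoeff w) =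
      w + (if b then 1 / 3 else 3) := by
  simp [sphereFunctional_single, sphereCoeff_mk, (Fin.succ_ne_zero k).symm]

/-- On the unit sphere, the functionals of one colour annihilate only the multiples of one
coefficient vector. -/
theorem eq_smul_sphereCoeff (b : Bool) (c : Sym2 (Fin (d + 1)) → ℝ)
    (h : ∀ x : EuclideanSpace ℝ (Fin d), ‖x‖ = 1 → sphereFunctional b x c = 0) (k₀ : Fin d) :
    ∃ r : ℝ, c = r • sphereCoeff (-(if b then 1 / 3 else 3)) := by
  set α : ℝ := if b then 1 / 3 else 3 with hα
  set β : ℝ := if b then 4 / 3 else 4 with hβ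
  have hα0 : α ≠ 0 := by rw [hα]; split_ifs <;> norm_num
  have hβ0 : β ≠ 0 := by rw [hβ]; split_ifs <;> norm_num
  have h1 : ∀ k : Fin d, c s(0, 0) + β * (c s(0, k.succ) * 1) +
      α * (c s(k.succ, k.succ) * 1 * 1) = 0 := fun k => by
    rw [← h (EuclideanSpace.single k 1) (by simp), sphereFunctional_single]
  have h2 : ∀ k : Fin d, c s(0, 0) + β * (c s(0, k.succ) * (-1)) +
      α * (c s(k.succ, k.succ) * (-1) * (-1)) = 0 := fun k => by
    rw [← h (EuclideanSpace.single k (-1)) (by simp), sphereFunctional_single]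
  have hz : ∀ k : Fin d, c s(0, k.succ) = 0 := fun k => by
    have : β * c s(0, k.succ) = 0 := by linarith [h1 k, h2 k]
    exact (mul_eq_zero.1 this).resolve_left hβ0
  have hd : ∀ k : Fin d, α * c s(k.succ, k.succ) = -c s(0, 0) := fun k => by
    linarith [h1 k, h2 k]
  have ho : ∀ k l : Fin d, k ≠ l → c s(k.succ, l.succ) = 0 := by
    intro k l hkl
    have hsw : c s(l.succ, k.succ) = c s(k.succ, l.succ) := by rw [Sym2.eq_swap]
    -- `(3/5, 4/5)` is a rational unit vector with both entries nonzero
    have hn : ‖EuclideanSpace.single k (3 / 5 : ℝ) + EuclideanSpace.single l (4 / 5 : ℝ)‖ = 1 := by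
      rw [← sq_eq_sq₀ (norm_nonneg _) zero_le_one, ← real_inner_self_eq_norm_sq]
      rw [inner_add_left, inner_add_right, inner_add_right]
      simp only [EuclideanSpace.inner_single_left, PiLp.single_apply, hkl, hkl.symm, if_true,
        if_false]
      norm_num
    have h3 := h _ hn
    have h5 : ∑ i, ∑ j, c s(i.succ, j.succ) *
        (EuclideanSpace.single k (3 / 5 : ℝ) + EuclideanSpace.single l (4 / 5 : ℝ)) i *
        (EuclideanSpace.single k (3 / 5 : ℝ) + EuclideanSpace.single l (4 / 5 : ℝ)) j =
        9 / 25 * c s(k.succ, k.succ) + 24 / 25 * c s(k.succ, l.succ) +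
          16 / 25 * c s(l.succ, l.succ) := by
      simp only [zero_mul, mul_zero, PiLp.add_apply, PiLp.single_apply, mul_add,
        Finset.sum_add_distrib, mul_ite, ite_mul, Finset.sum_ite_eq', Finset.mem_univ, if_true,
        add_mul, hsw]
      ring
    rw [sphereFunctional_apply, h5, ← hα] at h3
    simp only [hz, zero_mul, Finset.sum_const_zero, mul_zero, add_zero] at h3
    have h4 : α * c s(k.succ, l.succ) = 0 := by linarith [hd k, hd l]
    exact (mul_eq_zero.1 h4).resolve_left hα0
  refine ⟨c s(k₀.succ, k₀.succ), ?_⟩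
  have hd' : ∀ k : Fin d, c s(k.succ, k.succ) = c s(k₀.succ, k₀.succ) := fun k =>
    mul_left_cancel₀ hα0 ((hd k).trans (hd k₀).symm)
  funext s
  induction s using Sym2.ind with
  | _ i j =>
    rw [Pi.smul_apply, sphereCoeff_mk, smul_eq_mul]
    refine Fin.cases ?_ (fun k => ?_) i <;> refine Fin.cases ?_ (fun l => ?_) j
    · simp only [if_true]; linarith [hd k₀]
    · rw [if_neg (Fin.succ_ne_zero l).symm, hz, mul_zero]
    · rw [if_neg (Fin.succ_ne_zero k), Sym2.eq_swap, hz, mul_zero]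
    · by_cases hkl : k = l
      · subst hkl; simp [Fin.succ_ne_zero, hd' k]
      · rw [if_neg fun h => hkl (Fin.succ_injective _ h), ho k l hkl, mul_zero]

/-- Points on the unit sphere can be chosen such that the functionals of their colours are jointly
injective. One vertex of each colour is placed at the same point; the vectors that exceptionally
escape the functionals of one colour are already excluded by the vertex of the other colour. -/
theorem exists_sphere_injective [Fintype V] (hd : 0 < d)
    (hV : Fintype.card V = (d + 2).choose 2) (color : V → Bool) {u₀ v₀ : V}
    (hu₀ : color u₀ = true) (hv₀ : color v₀ = false) :
    ∃ x : Realization V d, (∀ v, ‖x v‖ = 1) ∧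
      ∀ c, (∀ v, sphereFunctional (color v) (x v) c = 0) → c = 0 := by
  classical
  let k₀ : Fin d := ⟨0, hd⟩
  let e₀ : EuclideanSpace ℝ (Fin d) := EuclideanSpace.single k₀ 1
  have he₀ : ‖e₀‖ = 1 := by simp [e₀]
  set U₁ := LinearMap.ker (sphereFunctional true e₀) with hU₁
  set U := U₁ ⊓ LinearMap.ker (sphereFunctional false e₀) with hU
  have hlt₁ : U₁ < ⊤ := by
    refine lt_top_iff_ne_top.2 fun h => ?_
    have : (sphereCoeff 1 : Sym2 (Fin (d + 1)) → ℝ) ∈ U₁ := h ▸ trivial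
    rw [hU₁, LinearMap.mem_ker, sphereFunctional_sphereCoeff] at this
    norm_num at this
  have hlt : U < U₁ := by
    refine lt_of_le_of_ne inf_le_left fun h => ?_
    have h1 : (sphereCoeff (-(1 / 3)) : Sym2 (Fin (d + 1)) → ℝ) ∈ U₁ := by
      rw [hU₁, LinearMap.mem_ker, sphereFunctional_sphereCoeff]; norm_num
    have h2 := (h.ge h1).2
    rw [SetLike.mem_coe, LinearMap.mem_ker, sphereFunctional_sphereCoeff] at h2
    norm_num at h2
  have hfin₁ := Submodule.finrank_lt_finrank_of_lt hlt₁
  have hfin := Submodule.finrank_lt_finrank_of_lt hlt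
  rw [finrank_top, finrank_fintype_fun_eq_card, card_sym2_fin, ← hV] at hfin₁
  have hne : u₀ ≠ v₀ := fun h => by rw [h, hv₀] at hu₀; cases hu₀
  let S : Finset V := (Finset.univ.erase u₀).erase v₀
  have hS : S.card = Fintype.card V - 1 - 1 := by
    rw [Finset.card_erase_of_mem (Finset.mem_erase.2 ⟨hne.symm, Finset.mem_univ _⟩),
      Finset.card_erase_of_mem (Finset.mem_univ _), Finset.card_univ]
  have : Nonempty {x : EuclideanSpace ℝ (Fin d) // ‖x‖ = 1} := ⟨⟨e₀, he₀⟩⟩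
  obtain ⟨x, hx⟩ := exists_choice_injOn (ι := V) (X := {x : EuclideanSpace ℝ (Fin d) // ‖x‖ = 1})
    (fun v x => sphereFunctional (color v) x.1) S U (by
      intro v _ w hw hw0
      by_contra! hcon
      obtain ⟨r, rfl⟩ := eq_smul_sphereCoeff (color v) w (fun x hx => hcon ⟨x, hx⟩) k₀
      have h1 := hw.1
      have h2 := hw.2
      rw [hU₁] at h1
      rw [SetLike.mem_coe, LinearMap.mem_ker, map_smul, sphereFunctional_sphereCoeff,
        smul_eq_mul] at h1 h2
      apply hw0
      -- use the functional of the colour opposite to that of `v`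
      have hr : r = 0 := by
        cases hc : color v
        · rw [hc] at h1; norm_num at h1; exact h1
        · rw [hc] at h2; norm_num at h2; exact h2
      rw [hr, zero_smul]) (by omega)
  refine ⟨fun v => if v ∈ S then (x v).1 else e₀, fun v => ?_, fun c hc => ?_⟩
  · dsimp only
    split_ifs
    exacts [(x v).2, he₀]
  · refine hx c ⟨?_, ?_⟩ fun v hv => ?_
    · have := hc u₀
      exact LinearMap.mem_ker.2 (by simpa only [show u₀ ∉ S by simp [S], if_false, hu₀] using this)
    · have := hc v₀
      exact LinearMap.mem_ker.2 (by simpa only [show v₀ ∉ S by simp [S], if_false, hv₀] using this)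
    · have := hc v
      simpa only [hv, if_true] using this

theorem contDiff_displace [Fintype V] (color : V → Bool) :
    ContDiff ℝ 1 (displace (d := d) color) := by
  have hx : ∀ (v : V) (k : Fin d), ContDiff ℝ 1
      fun z : (Sym2 (Fin (d + 1)) → ℝ) × Realization V d => z.2 v k := fun v k => by fun_prop
  have hhat : ∀ (v : V) (i : Fin (d + 1)), ContDiff ℝ 1
      fun z : (Sym2 (Fin (d + 1)) → ℝ) × Realization V d => hat (z.2 v) i := by
    intro v i
    refine Fin.cases ?_ (fun k => ?_) i
    · exact contDiff_const
    · exact hx v k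
  have hc : ∀ s : Sym2 (Fin (d + 1)), ContDiff ℝ 1
      fun z : (Sym2 (Fin (d + 1)) → ℝ) × Realization V d => z.1 s := fun s => by fun_prop
  refine ContDiff.prodMk (contDiff_pi.2 fun v => ?_) (contDiff_pi.2 fun v => ?_)
  · exact ContDiff.sum fun i _ => ContDiff.sum fun j _ => ((hc _).mul (hhat v i)).mul (hhat v j)
  · rw [contDiff_euclidean]
    intro k
    have h : ContDiff ℝ 1 fun z : (Sym2 (Fin (d + 1)) → ℝ) × Realization V d =>
        ∑ j, z.1 s(k.succ, j) * hat (z.2 v) j :=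
      ContDiff.sum fun j _ => (hc s(k.succ, j)).mul (hhat v j)
    exact (hx v k).add (contDiff_const.mul h)

theorem hasDerivAt_hat_line (x η : EuclideanSpace ℝ (Fin d)) (i : Fin (d + 1)) :
    HasDerivAt (fun t : ℝ => hat (x + t • η) i) ((Fin.cons 0 fun k => η k : Fin (d + 1) → ℝ) i)
      0 := by
  refine Fin.cases ?_ (fun k => ?_) i
  · exact hasDerivAt_const _ _
  · have h : HasDerivAt (fun t : ℝ => x k + t * η k) (η k) 0 := by
      simpa using ((hasDerivAt_id (0 : ℝ)).mul_const (η k)).const_add (x k)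
    exact h

theorem hasDerivAt_coeff_line (c δ : Sym2 (Fin (d + 1)) → ℝ) (s : Sym2 (Fin (d + 1))) :
    HasDerivAt (fun t : ℝ => (c + t • δ) s) (δ s) 0 := by
  simpa using ((hasDerivAt_id (0 : ℝ)).mul_const (δ s)).const_add (c s)

theorem hasDerivAt_halfGrad_line (c δ : Sym2 (Fin (d + 1)) → ℝ) (x η : EuclideanSpace ℝ (Fin d))
    (k : Fin d) :
    HasDerivAt (fun t : ℝ => halfGrad (c + t • δ) (x + t • η) k)
      (halfGrad δ x k + ∑ l, c s(k.succ, l.succ) * η l) 0 := by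
  have h := HasDerivAt.fun_sum (u := Finset.univ) fun j (_ : j ∈ Finset.univ) =>
    (hasDerivAt_coeff_line c δ s(k.succ, j)).mul (hasDerivAt_hat_line x η j)
  refine h.congr_deriv ?_
  simp only [zero_smul, add_zero, Finset.sum_add_distrib, halfGrad_apply]
  congr 1
  simp [Fin.sum_univ_succ]

theorem hasDerivAt_quadForm_line (c δ : Sym2 (Fin (d + 1)) → ℝ) (x η : EuclideanSpace ℝ (Fin d)) :
    HasDerivAt (fun t : ℝ => quadForm (c + t • δ) (hat (x + t • η)))
      (quadForm δ (hat x) + 2 * inner ℝ (halfGrad c x) η) 0 := by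
  have h := HasDerivAt.fun_sum (u := Finset.univ) fun i (_ : i ∈ Finset.univ) =>
    HasDerivAt.fun_sum (u := Finset.univ) fun j (_ : j ∈ Finset.univ) =>
    ((hasDerivAt_coeff_line c δ s(i, j)).mul (hasDerivAt_hat_line x η i)).mul
      (hasDerivAt_hat_line x η j)
  refine h.congr_deriv ?_
  simp only [Pi.mul_apply, zero_smul, add_zero, quadForm]
  set ζ : Fin (d + 1) → ℝ := Fin.cons 0 fun k => η k with hζ
  have h1 : inner ℝ (halfGrad c x) η = ∑ i, ∑ j, c s(i, j) * ζ i * hat x j := by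
    rw [Fin.sum_univ_succ, PiLp.inner_apply]
    simp only [hζ, Fin.cons_zero, Fin.cons_succ, mul_zero, zero_mul, Finset.sum_const_zero,
      zero_add, halfGrad_apply, RCLike.inner_apply, conj_trivial, Finset.mul_sum]
    exact Finset.sum_congr rfl fun k _ => Finset.sum_congr rfl fun j _ => by ring
  have h2 : inner ℝ (halfGrad c x) η = ∑ i, ∑ j, c s(i, j) * hat x i * ζ j := by
    rw [h1, Finset.sum_comm]
    refine Finset.sum_congr rfl fun i _ => Finset.sum_congr rfl fun j _ => ?_
    rw [Sym2.eq_swap]; ring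
  rw [two_mul]
  nth_rewrite 1 [h1]
  rw [h2]
  simp only [← Finset.sum_add_distrib]
  exact Finset.sum_congr rfl fun i _ => Finset.sum_congr rfl fun j _ => by ring

theorem quadForm_half_sphereCoeff (x : EuclideanSpace ℝ (Fin d)) (hx : ‖x‖ = 1) :
    quadForm ((1 / 2 : ℝ) • sphereCoeff (-1)) (hat x) = 0 := by
  rw [quadForm_smul, quadForm_hat]
  have h1 : ∑ k, x k ^ 2 = 1 := by
    have := real_inner_self_eq_norm_sq x
    rw [hx, PiLp.inner_apply] at this
    simpa [← sq] using this
  simp [sphereCoeff_mk, (Fin.succ_ne_zero _).symm, Fin.succ_ne_zero, Fin.succ_inj, ite_mul, ← sq,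
    h1]

theorem halfGrad_half_sphereCoeff (x : EuclideanSpace ℝ (Fin d)) :
    halfGrad ((1 / 2 : ℝ) • sphereCoeff (-1)) x = (1 / 2 : ℝ) • x := by
  ext k
  simp [halfGrad_apply, sphereCoeff_mk, Fin.succ_ne_zero]

/-- At points of the unit sphere with jointly injective functionals the derivative of `displace` is
injective, hence surjective. -/
theorem map_nhds_displace [Fintype V] (hV : Fintype.card V = (d + 2).choose 2) (color : V → Bool)
    (x : Realization V d)
    (hinj : ∀ c, (∀ v, sphereFunctional (color v) (x v) c = 0) → c = 0) :
    Filter.map (displace color) (𝓝 ((1 / 2 : ℝ) • sphereCoeff (-1), x)) =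
      𝓝 (displace color ((1 / 2 : ℝ) • sphereCoeff (-1), x)) := by
  set c₀ : Sym2 (Fin (d + 1)) → ℝ := (1 / 2 : ℝ) • sphereCoeff (-1) with hc₀
  have hstrict := (contDiff_displace (d := d) color).contDiffAt.hasStrictFDerivAt one_ne_zero
    (x := (c₀, x))
  set D := fderiv ℝ (displace color) (c₀, x) with hD
  refine hstrict.map_nhds_eq_of_surj ?_
  have hker : ∀ h, D h = 0 → h = 0 := by
    rintro ⟨δ, η⟩ h
    have hline : HasDerivAt (fun t : ℝ => displace color ((c₀, x) + t • (δ, η))) 0 0 := by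
      have h1 : HasDerivAt (fun t : ℝ => (c₀, x) + t • (δ, η)) (δ, η) 0 := by
        simpa using ((hasDerivAt_id (0 : ℝ)).smul_const (δ, η)).const_add (c₀, x)
      have h2 : HasFDerivAt (displace color) D ((fun t : ℝ => (c₀, x) + t • (δ, η)) 0) := by
        simpa using hstrict.hasFDerivAt
      have h3 := h2.comp_hasDerivAt (0 : ℝ) h1
      rwa [h] at h3
    have hA : ∀ v, quadForm δ (hat (x v)) + 2 * inner ℝ (halfGrad c₀ (x v)) (η v) = 0 := by
      intro v
      have h1 : HasDerivAt (fun t : ℝ => quadForm (c₀ + t • δ) (hat (x v + t • η v))) 0 0 :=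
        hasDerivAt_pi.1 (hline.fst) v
      exact (hasDerivAt_quadForm_line c₀ δ (x v) (η v)).unique h1
    have hB : ∀ v, η v + sgn (color v) • (halfGrad δ (x v) + (1 / 2 : ℝ) • η v) = 0 := by
      intro v
      ext k
      have h1 : HasDerivAt (fun t : ℝ => (x v + t • η v) k +
          sgn (color v) * halfGrad (c₀ + t • δ) (x v + t • η v) k) 0 0 := by
        have h2 := hasDerivAt_pi.1 (hline.snd) v
        exact ((EuclideanSpace.proj (𝕜 := ℝ) k).hasFDerivAt.comp_hasDerivAt (0 : ℝ) h2)
      have h3 := (hasDerivAt_hat_line (x v) (η v) k.succ).add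
        ((hasDerivAt_halfGrad_line c₀ δ (x v) (η v) k).const_mul (sgn (color v)))
      have h4 := h3.unique h1
      have h5 : ∑ l, c₀ s(k.succ, l.succ) * η v l = 1 / 2 * η v k := by
        simp [hc₀, sphereCoeff_mk, Fin.succ_ne_zero, Fin.succ_inj]
      rw [h5] at h4
      simpa [mul_add] using h4
    have hδ : δ = 0 := by
      refine hinj δ fun v => ?_
      have h1 := hA v
      rw [hc₀, halfGrad_half_sphereCoeff, inner_smul_left] at h1
      have h2 := congrArg (fun y => inner ℝ (x v) y) (hB v)
      simp only [inner_add_right, inner_smul_right, inner_zero_right] at h2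
      rw [inner_halfGrad] at h2
      rw [quadForm_hat] at h1
      rw [sphereFunctional_apply]
      simp only [conj_trivial] at h1
      cases hc : color v <;> simp only [hc, sgn, if_true, if_false, Bool.false_eq_true] at h2 ⊢ <;>
        linarith
    have hη : η = 0 := by
      funext v
      have h1 := hB v
      have h2 : halfGrad δ (x v) = 0 := by
        ext k; simp [halfGrad_apply, hδ]
      rw [h2, zero_add, smul_smul, ← one_smul ℝ (η v), smul_smul, ← add_smul] at h1
      refine (smul_eq_zero.1 h1).resolve_left ?_
      cases color v <;> norm_num [sgn]
    rw [hδ, hη]; rfl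
  have hinjD : Function.Injective
      (D : (Sym2 (Fin (d + 1)) → ℝ) × Realization V d →ₗ[ℝ] (V → ℝ) × Realization V d) := by
    rw [← LinearMap.ker_eq_bot, LinearMap.ker_eq_bot']
    exact hker
  refine LinearMap.range_eq_top.2 ?_
  refine (LinearMap.injective_iff_surjective_of_finrank_eq_finrank ?_).1 hinjD
  rw [finrank_prod, finrank_prod, finrank_fintype_fun_eq_card, finrank_fintype_fun_eq_card, hV,
    card_sym2_fin]

/-- A bipartite graph on `(d+2 choose 2)` vertices is not generically globally rigid. Displacing
points of a quadric along its gradient, one colour forwards and the other backwards, or conversely,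
gives two realizations with the same edge lengths, and by the inverse function theorem the
realizations obtained in this way near suitable points of a sphere form a neighbourhood. -/
theorem not_genericallyGloballyRigid_of_bipartite [Fintype V] (hd : 0 < d)
    (hV : Fintype.card V = (d + 2).choose 2) {H : SimpleGraph V}
    (color : V → Bool) (hcolor : ∀ u v, H.Adj u v → color u ≠ color v) {u₀ v₀ u₁ u₂ : V}
    (hu₀ : color u₀ = true) (hv₀ : color v₀ = false) (hne : u₁ ≠ u₂)
    (hcol : color u₁ = color u₂) : ¬ GenericallyGloballyRigid H d := by
  classical
  obtain ⟨x, hx, hinj⟩ := exists_sphere_injective hd hV color hu₀ hv₀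
  have hxne : x u₁ ≠ x u₂ := by
    intro heq
    let T : (Sym2 (Fin (d + 1)) → ℝ) →ₗ[ℝ] (V → ℝ) :=
      LinearMap.pi fun v => sphereFunctional (color v) (x v)
    have hT : Function.Injective T := by
      rw [← LinearMap.ker_eq_bot, LinearMap.ker_eq_bot']
      exact fun c hc => hinj c fun v => congrFun hc v
    have hsurj : Function.Surjective T :=
      (LinearMap.injective_iff_surjective_of_finrank_eq_finrank (by
        rw [finrank_fintype_fun_eq_card, finrank_fintype_fun_eq_card, hV, card_sym2_fin])).1 hT
    obtain ⟨c, hc⟩ := hsurj (Pi.single u₁ 1)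
    have h1 : sphereFunctional (color u₁) (x u₁) c = 1 := by
      simpa [T] using congrFun hc u₁
    have h2 : sphereFunctional (color u₂) (x u₂) c = 0 := by
      simpa [T, hne.symm] using congrFun hc u₂
    rw [hcol, heq, h2] at h1
    exact zero_ne_one h1
  set c₀ : Sym2 (Fin (d + 1)) → ℝ := (1 / 2 : ℝ) • sphereCoeff (-1) with hc₀
  let f : (Sym2 (Fin (d + 1)) → ℝ) × Realization V d → Realization V d := fun z =>
    (displace color z).2
  let g : (Sym2 (Fin (d + 1)) → ℝ) × Realization V d → Realization V d := fun z v =>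
    z.2 v - sgn (color v) • halfGrad z.1 (z.2 v)
  have hf : Continuous f := (contDiff_displace color).continuous.snd
  have hg : Continuous g := by
    have : g = fun z v => (2 : ℝ) • z.2 v - f z v := by
      funext z v
      simp only [f, g, displace]
      module
    rw [this]
    fun_prop
  -- at the base point the two realizations scale `x u₁ - x u₂` by different factors `1 ± 1/2`
  have hN : {z | dist (f z u₁) (f z u₂) ≠ dist (g z u₁) (g z u₂)} ∈ 𝓝 (c₀, x) := by
    refine IsOpen.mem_nhds (isOpen_ne_fun (by fun_prop) (by fun_prop)) ?_
    have hpos : 0 < ‖x u₁ - x u₂‖ := norm_pos_iff.2 (sub_ne_zero.2 hxne)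
    have h1 : f (c₀, x) u₁ - f (c₀, x) u₂ =
        (1 + sgn (color u₂) / 2) • (x u₁ - x u₂) := by
      simp only [f, displace, hc₀, halfGrad_half_sphereCoeff, hcol]
      module
    have h2 : g (c₀, x) u₁ - g (c₀, x) u₂ =
        (1 - sgn (color u₂) / 2) • (x u₁ - x u₂) := by
      simp only [g, hc₀, halfGrad_half_sphereCoeff, hcol]
      module
    rw [Set.mem_ofPred_eq, dist_eq_norm, dist_eq_norm, h1, h2, norm_smul, norm_smul]
    intro h3
    have h4 := mul_right_cancel₀ hpos.ne' h3
    cases hc : color u₂ <;> norm_num [hc, sgn, abs_of_pos] at h4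
  have himg : displace color '' {z | dist (f z u₁) (f z u₂) ≠ dist (g z u₁) (g z u₂)} ∈
      𝓝 (displace color (c₀, x)) := by
    rw [← map_nhds_displace hV color x hinj]
    exact image_mem_map hN
  have h0 : (displace color (c₀, x)).1 = 0 := funext fun v => quadForm_half_sphereCoeff _ (hx v)
  have hU : {p | ((0 : V → ℝ), p) ∈
      displace color '' {z | dist (f z u₁) (f z u₂) ≠ dist (g z u₁) (g z u₂)}} ∈
        𝓝 (f (c₀, x)) := by
    have hcont : Continuous fun p : Realization V d => ((0 : V → ℝ), p) := by fun_prop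
    refine hcont.continuousAt ?_
    rw [← h0]
    exact himg
  obtain ⟨p, ⟨z, hz, hzp⟩, hp⟩ := exists_generic_mem hU
  intro hrig
  have hquad : ∀ v, quadForm z.1 (hat (z.2 v)) = 0 := fun v => congrFun (congrArg Prod.fst hzp) v
  have hpz : f z = p := congrArg Prod.snd hzp
  have hlen : SameLengths H p (g z) := by
    rw [← hpz]
    exact sameLengths_displace hcolor z.1 z.2 hquad
  have hcong := hrig p hp (g z) hlen u₁ u₂ hne
  rw [← hpz] at hcong
  exact hz hcong

end

/-! ### Flexes of generic frameworks -/

section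
variable {V : Type*} {d : ℕ}

theorem hasDerivAt_norm_sub_sq {γ : ℝ → Realization V d} {γ' : Realization V d} {t : ℝ}
    (h : HasDerivAt γ γ' t) (u v : V) :
    HasDerivAt (fun t => ‖γ t u - γ t v‖ ^ 2) (2 * inner ℝ (γ t u - γ t v) (γ' u - γ' v)) t :=
  ((hasDerivAt_pi.1 h u).sub (hasDerivAt_pi.1 h v)).norm_sq

/-- For pairs of vertices with independent rows in the rigidity matrix, an infinitesimal motion `x`
is the initial velocity of a curve along which the distances of these pairs are constant: the
implicit function theorem corrects `p + t x` along a right inverse of the rigidity map. -/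
theorem exists_curve_of_surjective [Fintype V] {ι : Type*} [Fintype ι] (e : ι → V × V)
    (p x : Realization V d) (hsurj : Function.Surjective (edgeMap e p)) (hx : edgeMap e p x = 0) :
    ∃ γ : ℝ → Realization V d, γ 0 = p ∧ HasDerivAt γ x 0 ∧
      (∀ᶠ t in 𝓝 (0 : ℝ), DifferentiableAt ℝ γ t) ∧
      ∀ᶠ t in 𝓝 (0 : ℝ), ∀ i, ‖γ t (e i).1 - γ t (e i).2‖ ^ 2 = ‖p (e i).1 - p (e i).2‖ ^ 2 := by
  obtain ⟨B, hB⟩ := (edgeMap e p).exists_rightInverse_of_surjective (LinearMap.range_eq_top.2 hsurj)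
  let Bc : (ι → ℝ) →L[ℝ] Realization V d := LinearMap.toContinuousLinearMap B
  let q : ℝ × (ι → ℝ) → Realization V d := fun w => p + w.1 • x + Bc w.2
  let F : ℝ × (ι → ℝ) → ι → ℝ := fun w i => ‖q w (e i).1 - q w (e i).2‖ ^ 2
  have hq : ContDiff ℝ 1 q := by fun_prop
  have hF : ContDiff ℝ 1 F := by
    refine contDiff_pi.2 fun i => ContDiff.norm_sq ℝ ?_
    exact (contDiff_pi.1 hq _).sub (contDiff_pi.1 hq _)
  have hF0 : ContDiffAt ℝ 1 F (0, 0) := hF.contDiffAt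
  have hq0 : q (0, 0) = p := by simp [q]
  have hderiv : ∀ (t : ℝ) (s : ι → ℝ), fderiv ℝ F (0, 0) (t, s) = (2 : ℝ) • s := by
    intro t s
    have h1 : HasDerivAt (fun r : ℝ => ((0 : ℝ), (0 : ι → ℝ)) + r • (t, s)) (t, s) 0 := by
      simpa using ((hasDerivAt_id (0 : ℝ)).smul_const (t, s)).const_add ((0 : ℝ), (0 : ι → ℝ))
    have h2 : HasFDerivAt F (fderiv ℝ F (0, 0))
        ((fun r : ℝ => ((0 : ℝ), (0 : ι → ℝ)) + r • (t, s)) 0) := by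
      simpa using (hF0.differentiableAt one_ne_zero).hasFDerivAt
    have h3 := h2.comp_hasDerivAt (0 : ℝ) h1
    have h4 : HasDerivAt (fun r : ℝ => q (((0 : ℝ), (0 : ι → ℝ)) + r • (t, s)))
        (t • x + B s) 0 := by
      have : (fun r : ℝ => q (((0 : ℝ), (0 : ι → ℝ)) + r • (t, s))) =
          fun r : ℝ => p + r • (t • x + B s) := by
        funext r
        simp only [q, Prod.smul_mk, Prod.mk_add_mk, zero_add, map_smul, smul_add, smul_smul,
          smul_eq_mul, add_assoc]
        rfl
      rw [this]
      simpa using ((hasDerivAt_id (0 : ℝ)).smul_const (t • x + B s)).const_add p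
    funext i
    have h5 := (hasDerivAt_pi.1 h3 i).unique (hasDerivAt_norm_sub_sq h4 (e i).1 (e i).2)
    rw [h5]
    have h6 : edgeMap e p (t • x + B s) = s := by
      rw [map_add, map_smul, hx, smul_zero, zero_add]
      exact LinearMap.congr_fun hB s
    have h7 := congrFun h6 i
    rw [edgeMap_apply] at h7
    simp only [zero_smul, add_zero, hq0, Pi.smul_apply, smul_eq_mul]
    rw [h7]
  have hinv : (fderiv ℝ F (0, 0) ∘L .inr ℝ ℝ (ι → ℝ)).IsInvertible := by
    refine ⟨ContinuousLinearEquiv.smulLeft (Units.mk0 (2 : ℝ) two_ne_zero), ?_⟩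
    ext s i
    simp [hderiv, Units.smul_def]
  set ψ := hF0.implicitFunction one_ne_zero hinv with hψ
  have hψ0 : ψ 0 = 0 := hF0.implicitFunction_apply_self one_ne_zero hinv
  have hψc : ContDiffAt ℝ 1 ψ 0 := hF0.contDiffAt_implicitFunction one_ne_zero hinv
  have hψF : ∀ᶠ t in 𝓝 (0 : ℝ), F (t, ψ t) = F (0, 0) :=
    hF0.eventually_apply_implicitFunction one_ne_zero hinv
  -- the derivative of `F` in the first variable vanishes, because `x` is an infinitesimal motion
  have hψd : HasDerivAt ψ 0 0 := by
    have h1 := (hψc.differentiableAt one_ne_zero).hasDerivAt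
    have h2 : HasDerivAt (fun t : ℝ => (t, ψ t)) (1, deriv ψ 0) 0 :=
      (hasDerivAt_id (0 : ℝ)).prodMk h1
    have h3 : HasFDerivAt F (fderiv ℝ F (0, 0)) ((fun t : ℝ => (t, ψ t)) 0) := by
      simp only [hψ0]
      exact (hF0.differentiableAt one_ne_zero).hasFDerivAt
    have h4 := h3.comp_hasDerivAt (0 : ℝ) h2
    have h5 : HasDerivAt (F ∘ fun t : ℝ => (t, ψ t)) 0 0 :=
      (hasDerivAt_const (0 : ℝ) (F (0, 0))).congr_of_eventuallyEq hψF
    have h6 := h4.unique h5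
    rw [hderiv] at h6
    rwa [(smul_eq_zero.1 h6).resolve_left two_ne_zero] at h1
  refine ⟨fun t => q (t, ψ t), ?_, ?_, ?_, ?_⟩
  · simp only [hψ0, hq0]
  · have h1 : HasDerivAt (fun t : ℝ => p + t • x + Bc (ψ t)) ((1 : ℝ) • x + Bc 0) 0 :=
      (((hasDerivAt_id (0 : ℝ)).smul_const x).const_add p).add
        (Bc.hasFDerivAt.comp_hasDerivAt (0 : ℝ) hψd)
    simpa using h1
  · filter_upwards [hψc.eventually (by simp)] with t ht
    exact (hq.differentiable one_ne_zero).differentiableAt.comp t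
      (differentiableAt_id.prodMk (ht.differentiableAt one_ne_zero))
  · filter_upwards [hψF] with t ht i
    have := congrFun ht i
    simpa only [F, hq0] using this

/-- At a generic realization, an infinitesimal motion of `H` extends to a flexing of `H`. Therefore,
if the infinitesimal motion changes some distance to first order, the framework is not locally
rigid. The curve is constructed to preserve the lengths of a maximal independent set of edges; as
the rank cannot exceed its value at the generic realization, the other lengths are then preserved as
well. -/
theorem Generic.not_locallyRigid [Fintype V] {p : Realization V d} (hp : Generic p)
    {H : SimpleGraph V} {x : Realization V d} (hx : IsInfMotion H p x) {u v : V}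
    (huv : inner ℝ (p u - p v) (x u - x v) ≠ 0) : ¬ LocallyRigid H p := by
  classical
  let row : {e : V × V // H.Adj e.1 e.2} → Realization V d →ₗ[ℝ] ℝ := fun i =>
    (LinearMap.proj i).comp (edgeMap (orientedEdges H) p)
  obtain ⟨κ, f, hf, hspan, hind⟩ := exists_linearIndependent' ℝ row
  have : Fintype κ := Fintype.ofInjective f hf
  set e : κ → V × V := orientedEdges H ∘ f with he
  have hsurj : Function.Surjective (edgeMap e p) := by
    rw [← LinearMap.range_eq_top]
    by_contra hne
    obtain ⟨φ, hφ, hle⟩ := Submodule.exists_le_ker_of_lt_top _ (lt_top_iff_ne_top.2 hne)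
    refine hφ (LinearMap.pi_ext' fun i => ?_)
    ext
    have hsum : ∑ i, φ (Pi.single i 1) • (row ∘ f) i = 0 := by
      refine LinearMap.ext fun y => ?_
      have h1 : φ (edgeMap e p y) = 0 := hle ⟨y, rfl⟩
      rw [LinearMap.pi_apply_eq_sum_univ φ] at h1
      rw [LinearMap.zero_apply, ← h1, LinearMap.sum_apply]
      refine Finset.sum_congr rfl fun i _ => ?_
      rw [LinearMap.smul_apply, smul_eq_mul, smul_eq_mul, mul_comm]
      congr 2
      ext j
      simp [Pi.single_apply, eq_comm]
    simpa using Fintype.linearIndependent_iff.1 hind _ hsum i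
  have hker : ∀ q : Realization V d, LinearMap.ker (edgeMap (orientedEdges H) q) ≤
      LinearMap.ker (edgeMap e q) := by
    intro q y hy
    rw [LinearMap.mem_ker] at hy ⊢
    funext i
    exact congrFun hy (f i)
  have hrank : edgeRank (orientedEdges H) p ≤ edgeRank e p := by
    have hker' : LinearMap.ker (edgeMap e p) ≤ LinearMap.ker (edgeMap (orientedEdges H) p) := by
      intro y hy
      rw [LinearMap.mem_ker] at hy ⊢
      have hle : Submodule.span ℝ (Set.range (row ∘ f)) ≤
          LinearMap.ker (LinearMap.applyₗ (R := ℝ) (M₂ := ℝ) y) := by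
        rw [Submodule.span_le]
        rintro _ ⟨i, rfl⟩
        exact congrFun hy i
      rw [hspan] at hle
      funext i
      exact hle (Submodule.subset_span ⟨i, rfl⟩)
    have h1 := LinearMap.finrank_range_add_finrank_ker (edgeMap e p)
    have h2 := LinearMap.finrank_range_add_finrank_ker (edgeMap (orientedEdges H) p)
    have h3 := Submodule.finrank_mono hker'
    unfold edgeRank
    omega
  have hxe : edgeMap e p x = 0 :=
    hker p ((mem_ker_edgeMap_orientedEdges H p x).2 hx)
  obtain ⟨γ, hγ0, hγx, hγd, hγlen⟩ := exists_curve_of_surjective e p x hsurj hxe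
  have hopen : {q : Realization V d | edgeRank e p ≤ edgeRank e q} ∈ 𝓝 (γ 0) :=
    (isOpen_le_edgeRank e _).mem_nhds (by rw [hγ0]; exact le_refl (edgeRank e p))
  have hev : ∀ᶠ t in 𝓝 (0 : ℝ), DifferentiableAt ℝ γ t ∧ edgeRank e p ≤ edgeRank e (γ t) ∧
      ∀ i, ‖γ t (e i).1 - γ t (e i).2‖ ^ 2 = ‖p (e i).1 - p (e i).2‖ ^ 2 := by
    filter_upwards [hγd, hγx.continuousAt hopen, hγlen] with t h1 h2 h3
    exact ⟨h1, h2, h3⟩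
  obtain ⟨ε, hε, hball⟩ := Metric.eventually_nhds_iff_ball.1 hev
  have hconst : ∀ a b, H.Adj a b → ∀ t ∈ Metric.ball (0 : ℝ) ε,
      ‖γ t a - γ t b‖ ^ 2 = ‖p a - p b‖ ^ 2 := by
    intro a b hab t ht
    have hderiv : ∀ t ∈ Metric.ball (0 : ℝ) ε,
        HasDerivAt (fun t => ‖γ t a - γ t b‖ ^ 2) 0 t := by
      intro t ht
      obtain ⟨h1, h2, -⟩ := hball t ht
      have h3 := h1.hasDerivAt
      have h4 : edgeMap e (γ t) (deriv γ t) = 0 := by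
        funext i
        have h5 : HasDerivAt (fun t => ‖γ t (e i).1 - γ t (e i).2‖ ^ 2) 0 t := by
          refine (hasDerivAt_const t (‖p (e i).1 - p (e i).2‖ ^ 2)).congr_of_eventuallyEq ?_
          filter_upwards [Metric.isOpen_ball.mem_nhds ht] with r hr
          exact (hball r hr).2.2 i
        have h6 := (hasDerivAt_norm_sub_sq h3 (e i).1 (e i).2).unique h5
        rw [edgeMap_apply]
        simpa using h6
      have h5 : deriv γ t ∈ LinearMap.ker (edgeMap (orientedEdges H) (γ t)) :=
        ker_edgeMap_le e (orientedEdges H) (hker _) ((hp.edgeRank_le _ _).trans (hrank.trans h2)) h4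
      rw [mem_ker_edgeMap_orientedEdges] at h5
      have h6 := hasDerivAt_norm_sub_sq h3 a b
      rwa [h5 a b hab, mul_zero] at h6
    have h1 := (convex_ball (0 : ℝ) ε).is_const_of_fderivWithin_eq_zero (𝕜 := ℝ)
      (f := fun t => ‖γ t a - γ t b‖ ^ 2)
      (fun t ht => (hderiv t ht).differentiableAt.differentiableWithinAt)
      (fun t ht => by
        rw [fderivWithin_of_isOpen Metric.isOpen_ball ht, (hderiv t ht).hasFDerivAt.fderiv]
        ext; simp) ht (Metric.mem_ball_self hε)
    simpa [hγ0] using h1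
  intro hrig
  -- the sine makes the curve defined at all times
  have hsin : ∀ t, ε / 2 * Real.sin t ∈ Metric.ball (0 : ℝ) ε := by
    intro t
    rw [mem_ball_zero_iff, Real.norm_eq_abs, abs_mul, abs_of_pos (half_pos hε)]
    nlinarith [Real.abs_sin_le_one t, abs_nonneg (Real.sin t)]
  have hflex : IsFlexing H p fun t => γ (ε / 2 * Real.sin t) := by
    refine ⟨fun t => ?_, by simp [hγ0], fun t a b hab => ?_⟩
    · exact DifferentiableAt.comp t (hball _ (hsin t)).1 (by fun_prop)
    · rw [dist_eq_norm, dist_eq_norm, ← sq_eq_sq₀ (norm_nonneg _) (norm_nonneg _)]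
      exact (hconst a b hab _ (hsin t)).symm
  have hcong := hrig _ hflex
  have hne : u ≠ v := by
    rintro rfl
    simp at huv
  have hd1 : HasDerivAt (fun t => γ (ε / 2 * Real.sin t)) ((ε / 2) • x) 0 := by
    have h1 : HasDerivAt (fun t => ε / 2 * Real.sin t) (ε / 2) 0 := by
      simpa using (Real.hasDerivAt_sin 0).const_mul (ε / 2)
    have h2 : HasDerivAt γ x (ε / 2 * Real.sin 0) := by simpa using hγx
    exact h2.scomp (0 : ℝ) h1
  have hd2 := hasDerivAt_norm_sub_sq hd1 u v
  have hd3 : HasDerivAt (fun t => ‖γ (ε / 2 * Real.sin t) u - γ (ε / 2 * Real.sin t) v‖ ^ 2)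
      0 0 := by
    have : (fun t => ‖γ (ε / 2 * Real.sin t) u - γ (ε / 2 * Real.sin t) v‖ ^ 2) =
        fun _ => ‖p u - p v‖ ^ 2 := by
      funext t
      have := hcong t u v hne
      rw [dist_eq_norm, dist_eq_norm] at this
      rw [this]
    rw [this]
    exact hasDerivAt_const _ _
  have h := hd2.unique hd3
  simp only [Real.sin_zero, mul_zero, hγ0, Pi.smul_apply, ← smul_sub, inner_smul_right] at h
  have : inner ℝ (p u - p v) (x u - x v) = 0 := by
    simpa [hε.ne'] using h
  exact huv this

end

/-! ### Stresses -/

section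
variable {V : Type*} [Fintype V] {d : ℕ}

/-- An equilibrium stress of the framework `H(p)`: a symmetric weight on the edges such that at each
vertex the weighted edge vectors cancel. -/
structure IsStress (H : SimpleGraph V) (p : Realization V d) (σ : V → V → ℝ) : Prop where
  symm : ∀ u v, σ u v = σ v u
  eq_zero : ∀ u v, ¬ H.Adj u v → σ u v = 0
  equilibrium : ∀ u, ∑ v, σ u v • (p u - p v) = 0

/-- If every stress vanishes on an edge, then after removing that edge some infinitesimal motion
changes its length to first order: otherwise its row in the rigidity matrix would be a combination
of the other rows, and the coefficients would form a stress. -/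
theorem exists_isInfMotion_of_stress_eq_zero {H : SimpleGraph V} {p : Realization V d} {a b : V}
    (hab : H.Adj a b) (h : ∀ σ, IsStress H p σ → σ a b = 0) :
    ∃ x, IsInfMotion (H.deleteEdges {s(a, b)}) p x ∧ inner ℝ (p a - p b) (x a - x b) ≠ 0 := by
  classical
  by_contra! hcon
  set H' := H.deleteEdges {s(a, b)} with hH'
  let ℓ : V × V → Realization V d →ₗ[ℝ] ℝ := fun e =>
    (LinearMap.proj e).comp (edgeMap id p)
  have hℓ : ∀ u v x, ℓ (u, v) x = inner ℝ (p u - p v) (x u - x v) := fun _ _ _ => rfl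
  have hmem : ℓ (a, b) ∈ Submodule.span ℝ
      (Set.range fun e : {e : V × V // H'.Adj e.1 e.2} => ℓ e.1) := by
    refine mem_span_of_iInf_ker_le_ker fun x hx => ?_
    rw [Submodule.mem_iInf] at hx
    exact hcon x fun u v huv => hx ⟨(u, v), huv⟩
  obtain ⟨c, hc⟩ := (Submodule.mem_span_range_iff_exists_fun ℝ).1 hmem
  -- `τ` need not be symmetric; `τ u v + τ v u` is the stress
  let τ : V → V → ℝ := fun u v =>
    (if (u, v) = (a, b) then 1 else 0) - if h : H'.Adj u v then c ⟨(u, v), h⟩ else 0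
  have hτ : ∀ x : Realization V d, ∑ u, ∑ v, τ u v * inner ℝ (p u - p v) (x u - x v) = 0 := by
    intro x
    have h1 : ∑ e : V × V, (if h : H'.Adj e.1 e.2 then c ⟨e, h⟩ else 0) * ℓ e x =
        ℓ (a, b) x := by
      rw [← hc, LinearMap.sum_apply]
      have : ∀ e : V × V, (if h : H'.Adj e.1 e.2 then c ⟨e, h⟩ else 0) * ℓ e x =
          if h : H'.Adj e.1 e.2 then c ⟨e, h⟩ * ℓ e x else 0 := fun e => by split_ifs <;> simp
      simp only [this]
      rw [Finset.sum_dite, Finset.sum_const_zero, add_zero]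
      refine Finset.sum_bij' (fun e _ => ⟨e.1, (Finset.mem_filter.1 e.2).2⟩)
        (fun e _ => ⟨e.1, Finset.mem_filter.2 ⟨Finset.mem_univ _, e.2⟩⟩) ?_ ?_ ?_ ?_ ?_ <;>
        simp
    have h2 : ∑ e : V × V, (if e = (a, b) then (1 : ℝ) else 0) * ℓ e x = ℓ (a, b) x := by simp
    rw [← Fintype.sum_prod_type (f := fun e : V × V =>
      τ e.1 e.2 * inner ℝ (p e.1 - p e.2) (x e.1 - x e.2))]
    rw [← sub_eq_zero.2 (h2.trans h1.symm), ← Finset.sum_sub_distrib]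
    exact Finset.sum_congr rfl fun e _ => sub_mul _ _ _
  have hba : ¬ H'.Adj b a := fun h => by simp [hH', Sym2.eq_swap] at h
  have hab' : ¬ H'.Adj a b := fun h => by simp [hH'] at h
  have hne := hab.ne
  have hσ : IsStress H p fun u v => τ u v + τ v u := by
    have hzero : ∀ u v, ¬ H.Adj u v → τ u v = 0 := by
      intro u v huv
      have h1 : (u, v) ≠ (a, b) := by
        rintro h
        rw [Prod.mk.injEq] at h
        exact huv (by rw [h.1, h.2]; exact hab)
      have h2 : ¬ H'.Adj u v := fun h => huv (SimpleGraph.deleteEdges_adj.1 h).1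
      simp only [τ, if_neg h1, dif_neg h2, sub_zero]
    refine ⟨fun u v => add_comm _ _, fun u v huv => ?_, fun w => ?_⟩
    · rw [hzero u v huv, hzero v u fun h => huv h.symm, add_zero]
    · refine ext_inner_right ℝ fun y => ?_
      rw [inner_zero_left, ← hτ (Pi.single w y), sum_inner]
      simp only [inner_smul_left, conj_trivial, inner_sub_right, mul_sub, Finset.sum_sub_distrib]
      have h1 : ∀ (u v : V), inner ℝ (p u - p v) ((Pi.single w y : Realization V d) u) =
          if u = w then inner ℝ (p w - p v) y else 0 := by
        intro u v
        by_cases h : u = w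
        · subst h; simp
        · simp [h]
      have h2 : ∀ (u v : V), inner ℝ (p u - p v) ((Pi.single w y : Realization V d) v) =
          if v = w then -inner ℝ (p w - p u) y else 0 := by
        intro u v
        by_cases h : v = w
        · subst h; simp only [Pi.single_eq_same, if_true]; rw [← inner_neg_left, neg_sub]
        · simp [h]
      simp only [h1, h2, mul_ite, mul_zero, Finset.sum_ite_eq', Finset.mem_univ, if_true]
      rw [Finset.sum_comm]
      simp only [Finset.sum_ite_eq', Finset.mem_univ, if_true, add_mul, Finset.sum_add_distrib,
        mul_neg, Finset.sum_neg_distrib, sub_neg_eq_add]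
  have h1 := h _ hσ
  simp [τ, hab', hba, hne, hne.symm] at h1

/-- A stress of a bipartite framework on `(d+2 choose 2)` generic points is an affine dependency of
the neighbours at each vertex, including the requirement that the weights sum to zero: the sums of
the weights, with signs according to the colours, form a linear dependency between the symmetric
squares of the homogeneous coordinate vectors. -/
theorem IsStress.sum_hat_eq_zero {H : SimpleGraph V} {p : Realization V d} {σ : V → V → ℝ}
    (hσ : IsStress H p σ) (hp : Generic p) (hV : Fintype.card V = (d + 2).choose 2)
    (color : V → Bool) (hcolor : ∀ u v, H.Adj u v → color u ≠ color v) (u : V)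
    (i : Fin (d + 1)) : ∑ v, σ u v * hat (p v) i = 0 := by
  set lam : V → ℝ := fun u => ∑ v, σ u v with hlam
  have h1 : ∀ u i, ∑ v, σ u v * hat (p v) i = lam u * hat (p u) i := by
    intro u i
    refine Fin.cases (by simp [hlam]) (fun k => ?_) i
    have h := congrArg (fun y => y k) (hσ.equilibrium u)
    simp only [WithLp.ofLp_sum, Finset.sum_apply, PiLp.smul_apply, PiLp.sub_apply, smul_eq_mul,
      mul_sub, Finset.sum_sub_distrib, PiLp.zero_apply, ← Finset.sum_mul] at h
    simp only [hat_succ, hlam]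
    linarith
  have hneg : ∀ u v, sgn (color v) * σ u v = -(sgn (color u) * σ u v) := by
    intro u v
    by_cases huv : H.Adj u v
    · rw [sgn_eq_neg (hcolor u v huv)]; ring
    · rw [hσ.eq_zero u v huv]; ring
  have h2 : (fun u => sgn (color u) * lam u) = 0 := by
    refine hp.hat_mul_hat_linearIndependent hV _ fun i j => ?_
    have h3 : ∀ i j, ∑ u, sgn (color u) * lam u * (hat (p u) i * hat (p u) j) =
        ∑ u, ∑ v, sgn (color u) * σ u v * (hat (p v) i * hat (p u) j) := by
      intro i j
      refine Finset.sum_congr rfl fun u _ => ?_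
      rw [show sgn (color u) * lam u * (hat (p u) i * hat (p u) j) =
        sgn (color u) * hat (p u) j * (lam u * hat (p u) i) by ring, ← h1, Finset.mul_sum]
      exact Finset.sum_congr rfl fun v _ => by ring
    have h4 : ∑ u, sgn (color u) * lam u * (hat (p u) i * hat (p u) j) =
        -∑ u, sgn (color u) * lam u * (hat (p u) j * hat (p u) i) := by
      rw [h3 i j, h3 j i, Finset.sum_comm, ← Finset.sum_neg_distrib]
      refine Finset.sum_congr rfl fun u _ => ?_
      rw [← Finset.sum_neg_distrib]
      refine Finset.sum_congr rfl fun v _ => ?_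
      rw [hσ.symm v u, hneg]; ring
    have h5 : ∑ u, sgn (color u) * lam u * (hat (p u) j * hat (p u) i) =
        ∑ u, sgn (color u) * lam u * (hat (p u) i * hat (p u) j) :=
      Finset.sum_congr rfl fun u _ => by ring
    linarith
  have h3 := congrFun h2 u
  rw [h1]
  have h4 : sgn (color u) ≠ 0 := by cases color u <;> simp [sgn]
  rw [(mul_eq_zero.1 h3).resolve_left h4, zero_mul]

end

/-! ### Chains with a small inner part -/

section
variable {k : ℕ} {a : Fin k → ℕ} {d : ℕ}

theorem chain_parity (u v : Σ i : Fin k, Fin (a i)) (h : (chain a).Adj u v) :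
    decide (u.1.val % 2 = 0) ≠ decide (v.1.val % 2 = 0) := by
  rw [chain_adj] at h
  rw [Ne, decide_eq_decide]
  omega

variable {p : Realization (Σ i : Fin k, Fin (a i)) d}
  {σ : (Σ i : Fin k, Fin (a i)) → (Σ i : Fin k, Fin (a i)) → ℝ}

theorem IsStress.sum_hat_eq_zero_of_neighbors (hσ : IsStress (chain a) p σ) (hp : Generic p)
    (hv : ∑ i, a i = (d + 2).choose 2) {u : Σ i : Fin k, Fin (a i)}
    {t : Finset (Σ i : Fin k, Fin (a i))} (ht : ∀ v, (chain a).Adj u v → v ∈ t)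
    (i : Fin (d + 1)) : ∑ v ∈ t, σ u v * hat (p v) i = 0 := by
  rw [← hσ.sum_hat_eq_zero hp (by simpa using hv) _ chain_parity u i]
  refine Finset.sum_subset (Finset.subset_univ _) fun v _ hv => ?_
  rw [hσ.eq_zero u v fun h => hv (ht v h), zero_mul]

/-- A stress of a generic chain vanishes on the edges to an end part from a neighbouring part with
`d + 1` vertices. -/
theorem IsStress.eq_zero_of_end (hσ : IsStress (chain a) p σ) (hp : Generic p)
    (hv : ∑ i, a i = (d + 2).choose 2) {j : Fin k} (hj : a j = d + 1)
    {u v : Σ i : Fin k, Fin (a i)} (hu : ∀ w, (chain a).Adj u w → w ∈ part a j)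
    (hvj : v ∈ part a j) : σ u v = 0 :=
  hp.hat_linearIndependent (by rw [card_part, hj]) (σ u)
    (hσ.sum_hat_eq_zero_of_neighbors hp hv hu) v hvj

/-- The total of a stress between two consecutive parts, each edge weighted with the tensor product
of the homogeneous coordinates of its ends, vanishes. Equilibrium in the common part makes two
consecutive totals opposite transposes of each other, and the first total is zero. -/
theorem IsStress.sum_part_eq_zero (hσ : IsStress (chain a) p σ) (hp : Generic p)
    (hv : ∑ i, a i = (d + 2).choose 2) (m : ℕ) :
    ∀ i j : Fin k, i.val = m → j.val = m + 1 → ∀ α β : Fin (d + 1),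
      ∑ u ∈ part a i, ∑ v ∈ part a j, σ u v * hat (p v) β * hat (p u) α = 0 := by
  classical
  induction m with
  | zero =>
    intro i j hi hj α β
    refine Finset.sum_eq_zero fun u hu => ?_
    rw [← Finset.sum_mul, hσ.sum_hat_eq_zero_of_neighbors hp hv, zero_mul]
    intro v huv
    have hu' := mem_part.1 hu
    rw [chain_adj, hu'] at huv
    exact mem_part.2 (Fin.ext (by omega))
  | succ m ih =>
    intro i j hi hj α β
    let h : Fin k := ⟨m, by omega⟩
    have hdisj : Disjoint (part a h) (part a j) := by
      rw [Finset.disjoint_left]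
      intro v hv1 hv2
      have := congrArg Fin.val ((mem_part.1 hv1).symm.trans (mem_part.1 hv2))
      simp only [h] at this
      omega
    have h1 : ∑ u ∈ part a i, ∑ v ∈ part a h, σ u v * hat (p v) β * hat (p u) α = 0 := by
      rw [Finset.sum_comm, ← ih h i rfl hi β α]
      refine Finset.sum_congr rfl fun v _ => Finset.sum_congr rfl fun u _ => ?_
      rw [hσ.symm u v]; ring
    suffices h2 : ∑ u ∈ part a i, ∑ v ∈ part a h, σ u v * hat (p v) β * hat (p u) α +
        ∑ u ∈ part a i, ∑ v ∈ part a j, σ u v * hat (p v) β * hat (p u) α = 0 by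
      rwa [h1, zero_add] at h2
    rw [← Finset.sum_add_distrib]
    refine Finset.sum_eq_zero fun u hu => ?_
    rw [← Finset.sum_union hdisj, ← Finset.sum_mul,
      hσ.sum_hat_eq_zero_of_neighbors hp hv, zero_mul]
    intro v huv
    have hu' := mem_part.1 hu
    rw [chain_adj, hu'] at huv
    rw [Finset.mem_union, mem_part, mem_part]
    rcases huv with h' | h'
    · exact Or.inr (Fin.ext (by omega))
    · exact Or.inl (Fin.ext (by simp only [h]; omega))

/-- A stress of a generic chain vanishes between consecutive parts with `d + 1` vertices each. -/
theorem IsStress.eq_zero_of_consecutive (hσ : IsStress (chain a) p σ) (hp : Generic p)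
    (hv : ∑ i, a i = (d + 2).choose 2) {i j : Fin k} (hij : j.val = i.val + 1)
    (hi : a i = d + 1) (hj : a j = d + 1) {u v : Σ i : Fin k, Fin (a i)}
    (hu : u ∈ part a i) (hvj : v ∈ part a j) : σ u v = 0 := by
  refine hp.hat_linearIndependent (by rw [card_part, hj]) (σ u) (fun β => ?_) v hvj
  refine hp.hat_linearIndependent (by rw [card_part, hi])
    (fun u => ∑ v ∈ part a j, σ u v * hat (p v) β) (fun α => ?_) u hu
  rw [← hσ.sum_part_eq_zero hp hv i.val i j rfl hij α β]
  exact Finset.sum_congr rfl fun u _ => Finset.sum_mul _ _ _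

theorem not_genericallyRedundantlyRigid_of_stress {V : Type*} [Fintype V] {H : SimpleGraph V}
    {u v : V} (huv : H.Adj u v)
    (h : ∀ p : Realization V d, Generic p → ∀ σ, IsStress H p σ → σ u v = 0) :
    ¬ GenericallyRedundantlyRigid H d := by
  intro hrig
  obtain ⟨p, -, hp⟩ := exists_generic_mem (p := (0 : Realization V d)) Filter.univ_mem
  obtain ⟨x, hx, hne⟩ := exists_isInfMotion_of_stress_eq_zero huv (h p hp)
  exact hp.not_locallyRigid hx hne (hrig p hp _ huv)

/-! ### Connectivity of chains -/

theorem le_of_vertexConnected_chain (ha : ∀ i, 0 < a i)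
    (h : VertexConnected (chain a) (d + 1)) (i : Fin k) (h1 : 1 ≤ i.val) (h2 : i.val ≤ k - 2) :
    d + 1 ≤ a i := by
  by_contra hlt
  have hconn := h.2 (part a i) (by rw [card_part]; omega)
  have hstep : ∀ (x y : {v | v ∉ part a i}), ((chain a).induce {v | v ∉ part a i}).Walk x y →
      x.1.1.val < i.val → y.1.1.val < i.val := by
    intro x y w
    induction w with
    | nil => exact id
    | cons hadj _ ih =>
      rename_i x y z _
      intro hx
      refine ih ?_
      have hy : y.1.1 ≠ i := fun h => y.2 (mem_part.2 h)
      have hy' : y.1.1.val ≠ i.val := fun h => hy (Fin.ext h)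
      have := chain_adj.1 (SimpleGraph.comap_adj.1 hadj)
      simp only [Function.Embedding.subtype_apply] at this
      omega
  have hi := i.isLt
  let x : {v | v ∉ part a i} := ⟨⟨⟨0, by omega⟩, ⟨0, ha _⟩⟩, fun h => by
    have := congrArg Fin.val (mem_part.1 h)
    simp only at this
    omega⟩
  let y : {v | v ∉ part a i} := ⟨⟨⟨k - 1, by omega⟩, ⟨0, ha _⟩⟩, fun h => by
    have := congrArg Fin.val (mem_part.1 h)
    simp only at this
    omega⟩
  obtain ⟨w⟩ := hconn.preconnected x y
  have := hstep x y w (by simp only [x]; omega)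
  simp only [y] at this
  omega

/-- A chain whose inner parts have at least `d + 1` vertices is `(d + 1)`-connected: after removing
at most `d` vertices, each inner part retains a vertex, adjacent to all of the two neighbouring
parts. -/
theorem vertexConnected_chain (hk : 4 ≤ k)
    (hinner : ∀ i : Fin k, 1 ≤ i.val → i.val ≤ k - 2 → d + 1 ≤ a i)
    (hfirst : d + 2 ≤ a ⟨1, by omega⟩) : VertexConnected (chain a) (d + 1) := by
  classical
  constructor
  · rw [Fintype.card_sigma]
    simp only [Fintype.card_fin]
    have := Finset.single_le_sum (f := a) (fun _ _ => Nat.zero_le _)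
      (Finset.mem_univ (⟨1, by omega⟩ : Fin k))
    omega
  · intro S hS
    have hex : ∀ i : Fin k, 1 ≤ i.val → i.val ≤ k - 2 →
        ∃ v : {v | v ∉ S}, v.1.1 = i := by
      intro i h1 h2
      have hlt : S.card < (part a i).card := by
        rw [card_part]; exact lt_of_lt_of_le hS (hinner i h1 h2)
      obtain ⟨v, hv, hvS⟩ := Finset.exists_mem_notMem_of_card_lt_card hlt
      exact ⟨⟨v, hvS⟩, mem_part.1 hv⟩
    obtain ⟨r₁, hr₁⟩ := hex ⟨1, by omega⟩ le_rfl (by simp only; omega)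
    obtain ⟨r₂, hr₂⟩ := hex ⟨2, by omega⟩ (by simp) (by simp only; omega)
    have hadj : ∀ x y : {v | v ∉ S}, (x.1.1.val + 1 = y.1.1.val ∨ y.1.1.val + 1 = x.1.1.val) →
        ((chain a).induce {v | v ∉ S}).Reachable x y := fun x y h =>
      SimpleGraph.Adj.reachable (G := (chain a).induce {v | v ∉ S}) h
    have hv₁ : r₁.1.1.val = 1 := congrArg Fin.val hr₁
    have hv₂ : r₂.1.1.val = 2 := congrArg Fin.val hr₂
    have hreach : ∀ m : ℕ, ∀ x : {v | v ∉ S}, x.1.1.val = m + 1 →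
        ((chain a).induce {v | v ∉ S}).Reachable x r₁ := by
      intro m
      induction m with
      | zero => exact fun x hx => (hadj x r₂ (by omega)).trans (hadj r₂ r₁ (by omega))
      | succ m ih =>
        intro x hx
        have := x.1.1.isLt
        obtain ⟨y, hy⟩ := hex ⟨m + 1, by omega⟩ (by simp) (by simp only; omega)
        have hy' : y.1.1.val = m + 1 := congrArg Fin.val hy
        exact (hadj x y (by omega)).trans (ih y hy')
    have hall : ∀ x : {v | v ∉ S}, ((chain a).induce {v | v ∉ S}).Reachable x r₁ := by
      intro x
      by_cases hx : x.1.1.val = 0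
      · exact hadj x r₁ (by omega)
      · exact hreach (x.1.1.val - 1) x (by omega)
    have : Nonempty {v | v ∉ S} := ⟨r₁⟩
    exact ⟨fun x y => (hall x).trans (hall y).symm⟩

end

end Rigidity

theorem theorem2p1 (d k : ℕ) (hk : 4 ≤ k) (a : Fin k → ℕ) (ha : ∀ i, 0 < a i)
    (hv : ∑ i, a i = (d + 2).choose 2) :
    Rigidity.GenericallyPartiallyRigid (Rigidity.chain a) d ↔
      (∀ i : Fin k, 1 ≤ i.val → i.val ≤ k - 2 → d + 1 ≤ a i) ∧
      (d + 2 ≤ a ⟨1, by omega⟩ ∧ d + 2 ≤ a ⟨k - 2, by omega⟩) ∧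
      (¬ ∃ i j : Fin k, j.val = i.val + 1 ∧ a i = d + 1 ∧ a j = d + 1) := by
  constructor
  · rintro ⟨hconn, hred, -⟩
    have hinner := Rigidity.le_of_vertexConnected_chain ha hconn
    refine ⟨hinner, ⟨?_, ?_⟩, ?_⟩
    · by_contra hlt
      have h1 := hinner ⟨1, by omega⟩ le_rfl (by simp only; omega)
      have h2 : a ⟨1, by omega⟩ = d + 1 := by omega
      refine Rigidity.not_genericallyRedundantlyRigid_of_stress (H := Rigidity.chain a)
        (u := ⟨⟨0, by omega⟩, ⟨0, ha _⟩⟩) (v := ⟨⟨1, by omega⟩, ⟨0, ha _⟩⟩) (Or.inl rfl)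
        (fun p hp σ hσ => hσ.eq_zero_of_end hp hv h2 (fun w hw => ?_) (Rigidity.mem_part.2 rfl))
        hred
      rw [Rigidity.chain_adj] at hw
      exact Rigidity.mem_part.2 (Fin.ext (by simp only at hw ⊢; omega))
    · by_contra hlt
      have h1 := hinner ⟨k - 2, by omega⟩ (by simp only; omega) le_rfl
      have h2 : a ⟨k - 2, by omega⟩ = d + 1 := by omega
      refine Rigidity.not_genericallyRedundantlyRigid_of_stress (H := Rigidity.chain a)
        (u := ⟨⟨k - 1, by omega⟩, ⟨0, ha _⟩⟩) (v := ⟨⟨k - 2, by omega⟩, ⟨0, ha _⟩⟩)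
        (Or.inr (by simp only; omega))
        (fun p hp σ hσ => hσ.eq_zero_of_end hp hv h2 (fun w hw => ?_) (Rigidity.mem_part.2 rfl))
        hred
      rw [Rigidity.chain_adj] at hw
      have := w.1.isLt
      exact Rigidity.mem_part.2 (Fin.ext (by simp only at hw ⊢; omega))
    · rintro ⟨i, j, hij, hi, hj⟩
      exact Rigidity.not_genericallyRedundantlyRigid_of_stress (H := Rigidity.chain a)
        (u := ⟨i, ⟨0, ha _⟩⟩) (v := ⟨j, ⟨0, ha _⟩⟩) (Or.inl hij.symm)
        (fun p hp σ hσ => hσ.eq_zero_of_consecutive hp hv hij hi hj (Rigidity.mem_part.2 rfl)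
          (Rigidity.mem_part.2 rfl)) hred
  · rintro ⟨hinner, ⟨hfirst, hlast⟩, hcons⟩
    refine ⟨Rigidity.vertexConnected_chain hk hinner hfirst,
      Rigidity.genericallyRedundantlyRigid_chain hk ha hv hinner hfirst hlast hcons, ?_⟩
    -- for `d = 0` there is only one vertex
    have hd : 0 < d := by
      have h1 := Finset.single_le_sum (f := a) (fun _ _ => Nat.zero_le _)
        (Finset.mem_univ (⟨1, by omega⟩ : Fin k))
      rcases Nat.eq_zero_or_pos d with rfl | h
      · rw [hv] at h1
        simp at h1 hfirst
        omega
      · exact h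
    refine Rigidity.not_genericallyGloballyRigid_of_bipartite hd (by simpa using hv)
      (fun v => decide (v.1.val % 2 = 0)) Rigidity.chain_parity
      (u₀ := ⟨⟨0, by omega⟩, ⟨0, ha _⟩⟩) (v₀ := ⟨⟨1, by omega⟩, ⟨0, ha _⟩⟩)
      (u₁ := ⟨⟨1, by omega⟩, ⟨0, by omega⟩⟩) (u₂ := ⟨⟨1, by omega⟩, ⟨1, by omega⟩⟩)
      (by simp) (by simp) (by simp) rfl
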